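/- Let $\mathbb{T}=\mathbb{R}/\mathbb{Z}$ be the circle with its quotient distance $d$, and let a \emph{gauge function} be a nondecreasing right-continuous function $[0,\infty)\to[0,\infty)$ that vanishes at $0$ and only at $0$. For a gauge function $g$, let $\mathcal{H}^g$ denote the Hausdorff $g$-measure on $\mathbb{T}$, \[ \mathcal{H}^g(E)=\sup_{\delta>0}\ \inf\Big\{\sum_{n\ge 1} g(\operatorname{diam}U_n)\ :\ E\subseteq\bigcup_{n\ge 1}U_n,\ \operatorname{diam}U_n<\delta \text{ for all } n\Big\}. \] For gauge functions $g,h,\varphi$, write $h\prec_\varphi g$ if $g/h$ monotonically tends to zero at the origin (that is, $g/h$ is nondecreasing on some interval $(0,\varepsilon)$ with $\varepsilon>0$, and $g(x)/h(x)\to 0$ as $x\to 0^+$) and \[ \sum_{j=1}^{\infty}\frac{g(2^{-j})}{h(2^{-j})}\left(\frac{1}{\varphi(2^{-j})}-\frac{1}{\varphi(2^{-(j-1)})}\right)<\infty . \] Let $\mathrm{r}=(r_n)_{n\ge 1}$ be a sequence of real numbers in $(0,1]$, and let $\mathrm{X}=(X_n)_{n\ge 1}$ be a sequence of random variables with values in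 $\mathbb{T}$, defined on a common probability space, each of which is distributed according to the Lebesgue measure on $\mathbb{T}$ (no independence is assumed). Put \[ \mathcal{E}(\mathrm{X},\mathrm{r})=\{\xi\in\mathbb{T} : d(\xi,X_n)<r_n \text{ for infinitely many } n\ge 1\}. \] Let $q_n=\lceil 1/r_n\rceil$ and, for $0\le k<q_n$, let $I_{n,k}\subseteq\mathbb{T}$ be the image of $[k/q_n,(k+1)/q_n)$ under the projection modulo one. Let $\mathcal{B}(\mathrm{r})$ be the collection of all sequences $(I_{n,k_n})_{n\ge 1}$, where $(k_n)_{n\ge 1}$ is a sequence of integers with $0\le k_n<q_n$, and set \[ \Theta(\mathrm{X},\mathcal{B}(\mathrm{r}))=\sup_{(B_n)\in\mathcal{B}(\mathrm{r})}\ \sup_{n\ge 1}\ \frac{\mathbb{P}(X_1\in B_1,\ldots,X_n\in B_n)}{\mathbb{P}(X_1\in B_1)\cdots\mathbb{P}(X_n\in B_n)} . \] \textbf{Theorem.} Let $G$ be a nonempty compact subset of $\mathbb{T}$, and let $g$ be a gauge function such that $\mathcal{H}^g(G)>0$. Let $h$ and $\varphi$ be gauge functions such that $h\prec_\varphi g$.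 If $\Theta(\mathrm{X},\mathcal{B}(\mathrm{r}))<\infty$ and $\sum_{n\ge 1} r_n/\varphi(r_n)=\infty$, then almost surely $\mathcal{H}^h(\mathcal{E}(\mathrm{X},\mathrm{r})\cap G)>0$. -/

import Mathlib

open MeasureTheory Set Filter Topology
open scoped ENNReal

/-- A gauge function: a nondecreasing right-continuous real function on `[0,∞)` which vanishes at
zero and only at zero (its values at negative reals are irrelevant). -/
structure IsGauge (g : ℝ → ℝ) : Prop where
  mono : MonotoneOn g (Ici 0)
  rightCont : ∀ x, 0 ≤ x → ContinuousWithinAt g (Ici x) x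
  eq_zero_iff : ∀ x, 0 ≤ x → (g x = 0 ↔ x = 0)

/-- The Hausdorff `g`-measure on the circle `ℝ/ℤ` (with the quotient distance): the supremum over
`δ > 0` of the infimum of `∑ₙ g (diam Uₙ)` over countable covers by sets of diameter at most `δ`. -/
noncomputable def hausdorffGauge (g : ℝ → ℝ) : Measure UnitAddCircle :=
  Measure.mkMetric fun d : ℝ≥0∞ => ENNReal.ofReal (g d.toReal)

/-- `h ≺_φ g`: the gauge `h` increases `φ`-faster than `g`, i.e. `g / h` monotonically tends to
zero at the origin and
`∑_{j ≥ 1} g(2^{-j}) / h(2^{-j}) * (1 / φ(2^{-j}) - 1 / φ(2^{-(j-1)})) < ∞`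
(the terms are nonnegative; below `j` is shifted by one). -/
structure IncreasesFaster (φ h g : ℝ → ℝ) : Prop where
  monotone_near_zero : ∃ ε > 0, MonotoneOn (fun x => g x / h x) (Ioo 0 ε)
  tendsto_zero : Tendsto (fun x => g x / h x) (𝓝[>] 0) (𝓝 0)
  summable : Summable fun j : ℕ =>
    g ((2 : ℝ)⁻¹ ^ (j + 1)) / h ((2 : ℝ)⁻¹ ^ (j + 1)) *
      (1 / φ ((2 : ℝ)⁻¹ ^ (j + 1)) - 1 / φ ((2 : ℝ)⁻¹ ^ j))

/-- The set of points of the circle that lie at distance less than `r n` from `x n` for infinitely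
many `n`. -/
def approxSet (x : ℕ → UnitAddCircle) (r : ℕ → ℝ) : Set UnitAddCircle :=
  {ξ | ∃ᶠ n in atTop, dist ξ (x n) < r n}

/-- The image in the circle of the interval `[k/q, (k+1)/q)`. -/
def circleCell (q k : ℕ) : Set UnitAddCircle :=
  (fun t : ℝ => (t : UnitAddCircle)) '' Ico ((k : ℝ) / q) (((k : ℝ) + 1) / q)

/-- The collection of all the sequences `(I_{n, kₙ})ₙ` with `kₙ < qₙ`, where `qₙ = ⌈1 / rₙ⌉` and
`I_{n, k}` is the image in the circle of `[k/qₙ, (k+1)/qₙ)`. -/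
def cellSequences (r : ℕ → ℝ) : Set (ℕ → Set UnitAddCircle) :=
  {B | ∃ k : ℕ → ℕ, (∀ n, k n < ⌈1 / r n⌉₊) ∧ ∀ n, B n = circleCell ⌈1 / r n⌉₊ (k n)}

/-- The maximal ratio
`θ(X, B) = sup_n ℙ(X₀ ∈ B₀, …, Xₙ ∈ Bₙ) / (ℙ(X₀ ∈ B₀) ⋯ ℙ(Xₙ ∈ Bₙ))`. -/
noncomputable def dependenceRatio {Ω : Type*} [MeasurableSpace Ω] (P : Measure Ω)
    (X : ℕ → Ω → UnitAddCircle) (B : ℕ → Set UnitAddCircle) : ℝ≥0∞ :=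
  ⨆ n : ℕ, P {ω | ∀ i ≤ n, X i ω ∈ B i} / ∏ i ∈ Finset.range (n + 1), P {ω | X i ω ∈ B i}

/-- `Θ(X, 𝓑)`: the supremum of `θ(X, B)` over the sequences `B` in the collection `𝓑`. -/
noncomputable def maxDependenceRatio {Ω : Type*} [MeasurableSpace Ω] (P : Measure Ω)
    (X : ℕ → Ω → UnitAddCircle) (𝓑 : Set (ℕ → Set UnitAddCircle)) : ℝ≥0∞ :=
  ⨆ B ∈ 𝓑, dependenceRatio P X B

/-! Frostman's lemma puts on `G` a finite nonzero measure `μ` with mass at most `g (2⁻ᵏ)` on every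
dyadic cell of level `k`. Measures with bounded density with respect to `μ`, mass above a fixed `b`
and mass below `6 h (2⁻ᵏ)` on the cells of level `k` are called tame. Almost surely, a tame `ν` can
be refined, for any `N`, to a tame `ν' ≪ ν` carried by the cells that contain finitely many of the
points `X n` with `n ≥ N`. The constants `b` and `6` are the same for `ν'`; only the density bound
may grow. Iterating produces decreasing compact subsets of `G`, each carrying a tame measure, and a
mass distribution principle (`hausdorffGauge_iInter_pos`) gives their intersection positive
`h`-measure. Off the countable set of cell endpoints, the points of the intersection belong to
`approxSet`.

The refinement (`exists_functional_of_weights`) multiplies `ν` by a random density `∑ v n * 1_{cell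
of X n}` normalized to have mean one. Two causes of concentration are removed. Where the count of
cells weighted by `u n * v n`, with `u = g / h`, exceeds a threshold, the large cells overlap too
much; as `g / h` is monotone, below the threshold the large cells respect the gauge bound. The small
cells give each dyadic cell nearly the expected mass, and the few dyadic cells with a large
fluctuation are discarded. First and second moments bound the lost mass, provided that `v n * u n`
is uniformly small. Summation by parts in `h ≺_φ g` yields `g / h ≤ B φ` along dyadic scales
(`IncreasesFaster.exists_bound`), so weights proportional to `1 / φ (r n)` over a long block will
do, by divergence of `∑ r n / φ (r n)`. If the cell lengths do not tend to zero, one length recurs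
infinitely often and such cells cover the whole circle.

Moments are computed as if the cells were independent and uniform. Finiteness of `Θ` bounds the true
probabilities by a constant times the independent ones (`measure_le_cellAvg`), so a nonnegative
functional with arbitrarily small average shows that failure has probability zero. Each refined
measure depends on the sample only through a finite list of integers, so one null set serves all
stages. -/

/-! ### Cells of the circle and their indices. -/

/-- The representative in `[0, 1)` of a point of the circle. -/
noncomputable def circleRep (x : UnitAddCircle) : ℝ := (AddCircle.equivIco 1 0 x : ℝ)

lemma circleRep_mem (x : UnitAddCircle) : circleRep x ∈ Ico (0 : ℝ) 1 := by
  have := (AddCircle.equivIco (1 : ℝ) 0 x).2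
  simpa only [zero_add, circleRep] using this

lemma coe_circleRep (x : UnitAddCircle) : ((circleRep x : ℝ) : UnitAddCircle) = x :=
  AddCircle.coe_equivIco

lemma circleRep_coe (t : ℝ) : circleRep (t : UnitAddCircle) = Int.fract t := by
  simp [circleRep]

lemma measurable_circleRep : Measurable circleRep :=
  measurable_subtype_coe.comp (AddCircle.measurableEquivIco (1 : ℝ) 0).measurable

/-- The index of the cell of length `1 / q` that contains a given point. -/
noncomputable def cellIndex (q : ℕ) (x : UnitAddCircle) : ℕ := ⌊(q : ℝ) * circleRep x⌋₊

lemma measurable_cellIndex (q : ℕ) : Measurable (cellIndex q) :=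
  Nat.measurable_floor.comp (measurable_circleRep.const_mul _)

lemma cellIndex_lt {q : ℕ} (hq : 0 < q) (x : UnitAddCircle) : cellIndex q x < q := by
  have h := circleRep_mem x
  have hq' : (0 : ℝ) < q := by exact_mod_cast hq
  rw [cellIndex, Nat.floor_lt (by have := h.1; positivity)]
  nlinarith [h.2]

lemma coe_mem_circleCell {q : ℕ} (hq : 0 < q) {t : ℝ} (ht : 0 ≤ t) :
    (t : UnitAddCircle) ∈ circleCell q ⌊(q : ℝ) * t⌋₊ := by
  have hq' : (0 : ℝ) < q := by exact_mod_cast hq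
  refine ⟨t, ⟨?_, ?_⟩, rfl⟩
  · rw [div_le_iff₀ hq', mul_comm t]; exact Nat.floor_le (by positivity)
  · rw [lt_div_iff₀ hq', mul_comm t]; exact Nat.lt_floor_add_one _

lemma mem_circleCell_cellIndex {q : ℕ} (hq : 0 < q) (x : UnitAddCircle) :
    x ∈ circleCell q (cellIndex q x) := by
  have := coe_mem_circleCell hq (circleRep_mem x).1
  rwa [coe_circleRep] at this

/-- Cells are defined for every `k`, so those with `k ≥ q` wrap around the circle; the integer part
of a lift of the point is `k / q`. -/
lemma cellIndex_eq_mod {q : ℕ} (hq : 0 < q) {k : ℕ} {x : UnitAddCircle}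
    (hx : x ∈ circleCell q k) : cellIndex q x = k % q := by
  obtain ⟨t, ⟨h1, h2⟩, rfl⟩ := hx
  have hq' : (0 : ℝ) < q := by exact_mod_cast hq
  rw [div_le_iff₀ hq'] at h1
  rw [lt_div_iff₀ hq'] at h2
  have hk : (k : ℝ) = q * ((k / q : ℕ) : ℝ) + ((k % q : ℕ) : ℝ) := by
    exact_mod_cast (Nat.div_add_mod k q).symm
  have hm : ((k % q : ℕ) : ℝ) + 1 ≤ q := by exact_mod_cast Nat.mod_lt k hq
  have hm0 : (0 : ℝ) ≤ ((k % q : ℕ) : ℝ) := by positivity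
  generalize k / q = m at hk
  generalize k % q = l at hk hm hm0 ⊢
  have hfl : ⌊t⌋ = (m : ℤ) := by
    rw [Int.floor_eq_iff]
    constructor
    · push_cast; nlinarith
    · push_cast; nlinarith
  rw [cellIndex]
  simp only [circleRep_coe, Int.fract, hfl]
  rw [Nat.floor_eq_iff]
  · push_cast at *; constructor <;> nlinarith
  · push_cast at *; nlinarith

lemma circleCell_eq {q : ℕ} (hq : 0 < q) (k : ℕ) :
    circleCell q k = {x | cellIndex q x = k % q} := by
  ext x
  refine ⟨cellIndex_eq_mod hq, fun h => ?_⟩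
  have h' : cellIndex q x = k % q := h
  have hx := mem_circleCell_cellIndex hq x
  rw [h'] at hx
  obtain ⟨t, ⟨h1, h2⟩, rfl⟩ := hx
  have hq' : (0 : ℝ) < q := by exact_mod_cast hq
  have hk : (k : ℝ) = q * ((k / q : ℕ) : ℝ) + ((k % q : ℕ) : ℝ) := by
    exact_mod_cast (Nat.div_add_mod k q).symm
  rw [div_le_iff₀ hq'] at h1
  rw [lt_div_iff₀ hq'] at h2
  refine ⟨t + ((k / q : ℕ) : ℝ), ⟨?_, ?_⟩, ?_⟩
  · rw [div_le_iff₀ hq']; nlinarith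
  · rw [lt_div_iff₀ hq']; nlinarith
  · have := (AddCircle.coe_eq_coe_iff_of_mem_Ico (p := (1:ℝ)) (a := 0)
      (x := Int.fract (t + ((k / q : ℕ) : ℝ))) (y := Int.fract t)
      (by simp [Int.fract_lt_one]) (by simp [Int.fract_lt_one])).2 (by simp)
    have e : ∀ s : ℝ, ((Int.fract s : ℝ) : UnitAddCircle) = s := fun s => by
      rw [← circleRep_coe, coe_circleRep]
    rwa [e, e] at this

lemma circleCell_eq_of_lt {q k : ℕ} (hk : k < q) : circleCell q k = {x | cellIndex q x = k} := by
  rw [circleCell_eq (by omega), Nat.mod_eq_of_lt hk]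

lemma measurableSet_cellIndex_eq (q k : ℕ) : MeasurableSet {x | cellIndex q x = k} :=
  measurable_cellIndex q (measurableSet_singleton k)

lemma measurableSet_circleCell {q : ℕ} (hq : 0 < q) (k : ℕ) : MeasurableSet (circleCell q k) := by
  rw [circleCell_eq hq]; exact measurableSet_cellIndex_eq _ _

lemma dist_coe_le (s t : ℝ) : dist (s : UnitAddCircle) t ≤ |s - t| := by
  rw [dist_eq_norm, ← AddCircle.coe_sub, UnitAddCircle.norm_eq]
  have := round_le (s - t) 0
  simpa using this

lemma exists_coe_of_dist_lt {s d : ℝ} {y : UnitAddCircle} (h : dist y (s : UnitAddCircle) < d) :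
    ∃ t : ℝ, |t - s| < d ∧ (t : UnitAddCircle) = y := by
  have hy : y = ((circleRep y : ℝ) : UnitAddCircle) := (coe_circleRep y).symm
  rw [hy, dist_eq_norm, ← AddCircle.coe_sub, UnitAddCircle.norm_eq] at h
  refine ⟨circleRep y - round (circleRep y - s), ?_, ?_⟩
  · rwa [sub_right_comm]
  · conv_rhs => rw [hy]
    have : ((round (circleRep y - s) : ℝ) : UnitAddCircle) = 0 := by
      rw [AddCircle.coe_eq_zero_iff]; exact ⟨round (circleRep y - s), by simp⟩
    rw [AddCircle.coe_sub, this, sub_zero]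

lemma dist_lt_of_mem_circleCell {q k : ℕ} {x y : UnitAddCircle}
    (hx : x ∈ circleCell q k) (hy : y ∈ circleCell q k) : dist x y < 1 / q := by
  obtain ⟨s, ⟨h1, h2⟩, rfl⟩ := hx
  obtain ⟨t, ⟨h3, h4⟩, rfl⟩ := hy
  refine (dist_coe_le s t).trans_lt ?_
  rw [add_div] at h2 h4
  rw [abs_lt]; constructor <;> linarith

lemma ediam_circleCell_le (q k : ℕ) :
    Metric.ediam (circleCell q k) ≤ ENNReal.ofReal (1 / q) := by
  refine Metric.ediam_le fun x hx y hy => ?_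
  rw [edist_dist]
  exact ENNReal.ofReal_le_ofReal (dist_lt_of_mem_circleCell hx hy).le

lemma volume_circleCell_le {q : ℕ} (hq : 0 < q) (k : ℕ) :
    volume (circleCell q k) ≤ (q : ℝ≥0∞)⁻¹ := by
  have hq' : (0 : ℝ) < q := by exact_mod_cast hq
  have hsub : circleCell q k ⊆
      Metric.closedBall (((k : ℝ) / q + 1 / (2 * q) : ℝ) : UnitAddCircle) (1 / (2 * q)) := by
    rintro _ ⟨t, ⟨h1, h2⟩, rfl⟩
    refine (dist_coe_le _ _).trans ?_
    rw [add_div] at h2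
    have : (1 : ℝ) / q = 1 / (2 * q) + 1 / (2 * q) := by field_simp; norm_num
    rw [abs_le]; constructor <;> linarith
  refine (measure_mono hsub).trans ?_
  rw [AddCircle.volume_closedBall]
  refine (ENNReal.ofReal_le_ofReal (min_le_right _ _)).trans ?_
  rw [show 2 * (1 / (2 * (q : ℝ))) = (q : ℝ)⁻¹ by field_simp, ENNReal.ofReal_inv_of_pos hq',
    ENNReal.ofReal_natCast]

/-- The endpoints of the cells of length `1 / q`. -/
def cellEndpoints : Set UnitAddCircle :=
  range fun p : ℕ × ℕ => ((((p.1 : ℝ) + 1) / p.2 : ℝ) : UnitAddCircle)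

lemma countable_cellEndpoints : cellEndpoints.Countable := countable_range _

/-- Compact sets are needed later, but closing a cell may add its right endpoint, where the strict
distance bound can fail. All such points lie in one countable set, which is null for every gauge. -/
lemma closure_circleCell_subset (q k : ℕ) :
    closure (circleCell q k) ⊆ circleCell q k ∪ cellEndpoints := by
  have hc : IsCompact ((fun t : ℝ => (t : UnitAddCircle)) ''
      Icc ((k : ℝ) / q) (((k : ℝ) + 1) / q)) :=
    isCompact_Icc.image (AddCircle.continuous_mk' 1)
  refine (closure_minimal (image_mono Ico_subset_Icc_self) hc.isClosed).trans ?_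
  rintro _ ⟨t, ⟨h1, h2⟩, rfl⟩
  rcases h2.lt_or_eq with h | h
  · exact Or.inl ⟨t, ⟨h1, h⟩, rfl⟩
  · exact Or.inr ⟨(k, q), by simp [h]⟩

/-- An interval of length `1 / p ≤ 2 / q` meets at most three consecutive intervals of length `1 /
q`. -/
lemma circleCell_subset_iUnion {p q : ℕ} (hp : 0 < p) (hq : 0 < q) (hqp : q ≤ 2 * p) (i : ℕ) :
    ∃ n : ℕ, circleCell p i ⊆ ⋃ e ∈ Finset.range 3, circleCell q (n + e) := by
  have hp' : (0 : ℝ) < p := by exact_mod_cast hp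
  have hq' : (0 : ℝ) < q := by exact_mod_cast hq
  have hqp' : (q : ℝ) ≤ 2 * p := by exact_mod_cast hqp
  refine ⟨⌊(q : ℝ) * (i / p)⌋₊, ?_⟩
  rintro _ ⟨t, ⟨h1, h2⟩, rfl⟩
  have ht : 0 ≤ t := le_trans (by positivity) h1
  have hle : ⌊(q : ℝ) * (i / p)⌋₊ ≤ ⌊(q : ℝ) * t⌋₊ := Nat.floor_le_floor (by gcongr)
  have hlt : ⌊(q : ℝ) * t⌋₊ < ⌊(q : ℝ) * (i / p)⌋₊ + 3 := by
    rw [Nat.floor_lt (by positivity)]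
    have h3 := Nat.lt_floor_add_one ((q : ℝ) * (i / p))
    have h4 : (q : ℝ) * t < q * ((i + 1) / p) := by gcongr
    have h5 : (q : ℝ) * ((i + 1) / p) ≤ q * (i / p) + 2 := by
      rw [add_div, mul_add]
      have : (q : ℝ) * (1 / p) ≤ 2 := by rw [mul_one_div, div_le_iff₀ hp']; exact hqp'
      linarith
    push_cast; linarith
  simp only [mem_iUnion, Finset.mem_range]
  refine ⟨⌊(q : ℝ) * t⌋₊ - ⌊(q : ℝ) * (i / p)⌋₊, by omega, ?_⟩
  rw [Nat.add_sub_cancel' hle]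
  exact coe_mem_circleCell hq ht

/-- The ball lifts to an interval of length `2 * d ≤ 4 / q`, which meets at most five consecutive
cells. -/
lemma ball_subset_iUnion_circleCell {q : ℕ} (hq : 0 < q) {d : ℝ} (hd : d ≤ 1) (hqd : q * d ≤ 2)
    (x : UnitAddCircle) :
    ∃ n : ℕ, Metric.ball x d ⊆ ⋃ e ∈ Finset.range 5, circleCell q (n + e) := by
  have hq' : (0 : ℝ) < q := by exact_mod_cast hq
  have ha := circleRep_mem x
  set a := circleRep x with ha'
  -- The lifts are shifted by one full turn to make them nonnegative.
  refine ⟨⌊(q : ℝ) * (a + 1 - d)⌋₊, fun y hy => ?_⟩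
  rw [Metric.mem_ball, ← coe_circleRep x, ← ha'] at hy
  obtain ⟨t, ht, rfl⟩ := exists_coe_of_dist_lt hy
  rw [abs_lt] at ht
  have e : (t : UnitAddCircle) = ((t + 1 : ℝ) : UnitAddCircle) := by
    rw [AddCircle.coe_add, AddCircle.coe_period, add_zero]
  have ht0 : 0 ≤ t + 1 := by linarith [ha.1]
  have hle : ⌊(q : ℝ) * (a + 1 - d)⌋₊ ≤ ⌊(q : ℝ) * (t + 1)⌋₊ :=
    Nat.floor_le_floor (by gcongr; linarith)
  have hlt : ⌊(q : ℝ) * (t + 1)⌋₊ < ⌊(q : ℝ) * (a + 1 - d)⌋₊ + 5 := by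
    rw [Nat.floor_lt (by positivity)]
    have h3 := Nat.lt_floor_add_one ((q : ℝ) * (a + 1 - d))
    push_cast; nlinarith
  simp only [mem_iUnion, Finset.mem_range]
  refine ⟨⌊(q : ℝ) * (t + 1)⌋₊ - ⌊(q : ℝ) * (a + 1 - d)⌋₊, by omega, ?_⟩
  rw [Nat.add_sub_cancel' hle, e]
  exact coe_mem_circleCell hq ht0

/-! ### Measures dominated by a subadditive capacity on the dyadic tree. -/

/-- The mass distributed along the dyadic tree, proportionally to the capacities `c`. -/
noncomputable def treeMass (c : ℕ → ℕ → ℝ) : ℕ → ℕ → ℝ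
  | 0, i => c 0 i
  | k + 1, i => treeMass c k (i / 2) *
      (c (k + 1) i / (c (k + 1) (2 * (i / 2)) + c (k + 1) (2 * (i / 2) + 1)))

section TreeMass

variable {c : ℕ → ℕ → ℝ}

lemma treeMass_nonneg (hc : ∀ k i, 0 ≤ c k i) : ∀ k i, 0 ≤ treeMass c k i
  | 0, _ => hc 0 _
  | k + 1, _ => mul_nonneg (treeMass_nonneg hc k _)
      (div_nonneg (hc _ _) (add_nonneg (hc _ _) (hc _ _)))

/-- Inductively, the parent has mass at most its capacity, hence at most the sum of the capacities
of its children; a proportional split then gives each child at most its own capacity. -/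
lemma treeMass_le (hc : ∀ k i, 0 ≤ c k i)
    (hsub : ∀ k i, c k i ≤ c (k + 1) (2 * i) + c (k + 1) (2 * i + 1)) :
    ∀ k i, treeMass c k i ≤ c k i
  | 0, _ => le_rfl
  | k + 1, i => by
    have h1 := (treeMass_le hc hsub k (i / 2)).trans (hsub k (i / 2))
    have h0 := hc (k + 1) i
    have hs := add_nonneg (hc (k + 1) (2 * (i / 2))) (hc (k + 1) (2 * (i / 2) + 1))
    rw [treeMass, ← mul_div_assoc]
    exact div_le_of_le_mul₀ hs h0 (by rw [mul_comm]; exact mul_le_mul_of_nonneg_left h1 h0)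

lemma treeMass_add (hc : ∀ k i, 0 ≤ c k i)
    (hsub : ∀ k i, c k i ≤ c (k + 1) (2 * i) + c (k + 1) (2 * i + 1)) (k i : ℕ) :
    treeMass c (k + 1) (2 * i) + treeMass c (k + 1) (2 * i + 1) = treeMass c k i := by
  have e1 : 2 * i / 2 = i := by omega
  have e2 : (2 * i + 1) / 2 = i := by omega
  simp only [treeMass, e1, e2, ← mul_add, ← add_div]
  have hs := add_nonneg (hc (k + 1) (2 * i)) (hc (k + 1) (2 * i + 1))
  rcases hs.eq_or_lt with h | h
  -- When both children have capacity zero the quotients are `0 / 0 = 0`, but the parent then has no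
  -- mass to lose.
  · have h1 := (treeMass_le hc hsub k i).trans (hsub k i)
    have h2 := treeMass_nonneg hc k i
    have : treeMass c k i = 0 := le_antisymm (by rwa [← h] at h1) h2
    simp [this]
  · rw [div_self h.ne', mul_one]

lemma sum_treeMass_double (hc : ∀ k i, 0 ≤ c k i)
    (hsub : ∀ k i, c k i ≤ c (k + 1) (2 * i) + c (k + 1) (2 * i + 1)) (k n : ℕ) :
    ∑ i ∈ Finset.range (2 * n), treeMass c (k + 1) i = ∑ i ∈ Finset.range n, treeMass c k i := by
  induction n with
  | zero => simp
  | succ n ih =>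
    rw [Finset.sum_range_succ, ← ih, mul_add, mul_one, Finset.sum_range_succ,
      Finset.sum_range_succ, add_assoc, treeMass_add hc hsub]

lemma sum_treeMass_pow (hc : ∀ k i, 0 ≤ c k i)
    (hsub : ∀ k i, c k i ≤ c (k + 1) (2 * i) + c (k + 1) (2 * i + 1)) (k l n : ℕ) :
    ∑ i ∈ Finset.range (2 ^ l * n), treeMass c (k + l) i
      = ∑ i ∈ Finset.range n, treeMass c k i := by
  induction l with
  | zero => simp
  | succ l ih =>
    rw [← ih, pow_succ', mul_assoc, ← add_assoc, sum_treeMass_double hc hsub]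

/-- The approximation at level `k` of the distribution function of the tree mass. -/
noncomputable def treeCdfApprox (c : ℕ → ℕ → ℝ) (k : ℕ) (x : ℝ) : ℝ :=
  ∑ i ∈ Finset.range ⌊(2 : ℝ) ^ k * x⌋₊, treeMass c k i

/-- The distribution function of the tree mass. -/
noncomputable def treeCdf (c : ℕ → ℕ → ℝ) (x : ℝ) : ℝ := ⨆ k, treeCdfApprox c k x

lemma sum_treeMass_mono (hc : ∀ k i, 0 ≤ c k i) (k : ℕ) {m n : ℕ} (h : m ≤ n) :
    ∑ i ∈ Finset.range m, treeMass c k i ≤ ∑ i ∈ Finset.range n, treeMass c k i :=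
  Finset.sum_le_sum_of_subset_of_nonneg (Finset.range_mono h) fun i _ _ => treeMass_nonneg hc k i

lemma treeCdfApprox_mono (hc : ∀ k i, 0 ≤ c k i) (k : ℕ) : Monotone (treeCdfApprox c k) :=
  fun x y h => sum_treeMass_mono hc k (Nat.floor_le_floor (by gcongr))

lemma treeCdfApprox_le_add (hc : ∀ k i, 0 ≤ c k i)
    (hsub : ∀ k i, c k i ≤ c (k + 1) (2 * i) + c (k + 1) (2 * i + 1)) (k l : ℕ) {x : ℝ}
    (hx : 0 ≤ x) : treeCdfApprox c k x ≤ treeCdfApprox c (k + l) x := by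
  rw [treeCdfApprox, ← sum_treeMass_pow hc hsub k l]
  refine sum_treeMass_mono hc _ (Nat.le_floor ?_)
  push_cast
  have := Nat.floor_le (a := (2 : ℝ) ^ k * x) (by positivity)
  calc (2 : ℝ) ^ l * ⌊(2 : ℝ) ^ k * x⌋₊ ≤ 2 ^ l * (2 ^ k * x) := by gcongr
    _ = 2 ^ (k + l) * x := by ring

lemma treeCdfApprox_le (hc : ∀ k i, 0 ≤ c k i)
    (hsub : ∀ k i, c k i ≤ c (k + 1) (2 * i) + c (k + 1) (2 * i + 1)) (k : ℕ) (x : ℝ) :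
    treeCdfApprox c k x ≤ ∑ i ∈ Finset.range ⌈x⌉₊, treeMass c 0 i := by
  rw [treeCdfApprox, ← sum_treeMass_pow hc hsub 0 k, zero_add]
  refine sum_treeMass_mono hc _ (Nat.floor_le_of_le ?_)
  push_cast
  gcongr
  exact Nat.le_ceil x

lemma bddAbove_treeCdfApprox (hc : ∀ k i, 0 ≤ c k i)
    (hsub : ∀ k i, c k i ≤ c (k + 1) (2 * i) + c (k + 1) (2 * i + 1)) (x : ℝ) :
    BddAbove (range fun k => treeCdfApprox c k x) :=
  ⟨_, by rintro _ ⟨k, rfl⟩; exact treeCdfApprox_le hc hsub k x⟩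

lemma treeCdf_mono (hc : ∀ k i, 0 ≤ c k i)
    (hsub : ∀ k i, c k i ≤ c (k + 1) (2 * i) + c (k + 1) (2 * i + 1)) : Monotone (treeCdf c) :=
  fun _ y h => ciSup_mono (bddAbove_treeCdfApprox hc hsub y) fun k => treeCdfApprox_mono hc k h

/-- The approximations at levels beyond `k` all agree at multiples of `2⁻ᵏ`, since splitting
preserves the mass; the supremum is attained there. -/
lemma treeCdf_dyadic (hc : ∀ k i, 0 ≤ c k i)
    (hsub : ∀ k i, c k i ≤ c (k + 1) (2 * i) + c (k + 1) (2 * i + 1)) (k n : ℕ) :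
    treeCdf c ((n : ℝ) / 2 ^ k) = ∑ i ∈ Finset.range n, treeMass c k i := by
  have key : ∀ l, treeCdfApprox c (k + l) ((n : ℝ) / 2 ^ k)
      = ∑ i ∈ Finset.range n, treeMass c k i := fun l => by
    rw [treeCdfApprox, ← sum_treeMass_pow hc hsub k l]
    congr 2
    rw [show (2 : ℝ) ^ (k + l) * ((n : ℝ) / 2 ^ k) = ((2 ^ l * n : ℕ) : ℝ) by
      push_cast; field_simp; ring]
    exact Nat.floor_natCast _
  refine le_antisymm (ciSup_le fun l => ?_) ?_
  · rw [← key l, add_comm]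
    exact treeCdfApprox_le_add hc hsub l k (by positivity)
  · rw [← key 0]
    exact le_ciSup (bddAbove_treeCdfApprox hc hsub _) (k + 0)

lemma treeCdf_of_nonpos {x : ℝ} (hx : x ≤ 0) : treeCdf c x = 0 := by
  have : ∀ k, treeCdfApprox c k x = 0 := fun k => by
    rw [treeCdfApprox, Nat.floor_of_nonpos (mul_nonpos_of_nonneg_of_nonpos (by positivity) hx)]
    simp
  simp [treeCdf, this]

/-- An interval of length `2⁻ᵏ` in the half-line is contained in two adjacent cells of level `k`.
With capacities tending uniformly to zero this makes the distribution function continuous, so that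
the Stieltjes measure has no atoms. -/
lemma treeCdf_sub_le (hc : ∀ k i, 0 ≤ c k i)
    (hsub : ∀ k i, c k i ≤ c (k + 1) (2 * i) + c (k + 1) (2 * i + 1)) {γ : ℝ} {k : ℕ}
    (hγ : ∀ i, c k i ≤ γ) {x y : ℝ} (hxy : y ≤ x + (2 ^ k)⁻¹) :
    treeCdf c y - treeCdf c x ≤ 2 * γ := by
  have h2 : (0 : ℝ) < 2 ^ k := by positivity
  have hx : treeCdf c (max x 0) = treeCdf c x := by
    rcases le_total x 0 with h | h
    · rw [max_eq_right h, treeCdf_of_nonpos le_rfl, treeCdf_of_nonpos h]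
    · rw [max_eq_left h]
  rw [← hx]
  set z := max x 0 with hz
  have hz0 : 0 ≤ z := le_max_right _ _
  have hyz : y ≤ z + (2 ^ k)⁻¹ := hxy.trans (by gcongr; exact le_max_left _ _)
  set m := ⌊(2 : ℝ) ^ k * z⌋₊
  have hm1 : (m : ℝ) / 2 ^ k ≤ z := by
    rw [div_le_iff₀ h2, mul_comm]; exact Nat.floor_le (by positivity)
  have hm2 : y ≤ ((m + 2 : ℕ) : ℝ) / 2 ^ k := by
    rw [le_div_iff₀ h2]
    have h3 := Nat.lt_floor_add_one ((2 : ℝ) ^ k * z)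
    have h4 : y * 2 ^ k ≤ (z + (2 ^ k)⁻¹) * 2 ^ k := by gcongr
    rw [add_mul, inv_mul_cancel₀ h2.ne'] at h4
    push_cast
    change _ < (m : ℝ) + 1 at h3
    linarith
  have h5 := treeCdf_mono hc hsub hm1
  have h6 := treeCdf_mono hc hsub hm2
  rw [treeCdf_dyadic hc hsub] at h5 h6
  rw [Finset.sum_range_succ, Finset.sum_range_succ] at h6
  have h7 := (treeMass_le hc hsub k m).trans (hγ m)
  have h8 := (treeMass_le hc hsub k (m + 1)).trans (hγ (m + 1))
  linarith

lemma continuous_treeCdf (hc : ∀ k i, 0 ≤ c k i)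
    (hsub : ∀ k i, c k i ≤ c (k + 1) (2 * i) + c (k + 1) (2 * i + 1)) {γ : ℕ → ℝ}
    (hγ : ∀ k i, c k i ≤ γ k) (hγ0 : Tendsto γ atTop (𝓝 0)) : Continuous (treeCdf c) := by
  rw [Metric.continuous_iff]
  intro x ε hε
  obtain ⟨k, hk⟩ := ((tendsto_order.1 hγ0).2 (ε / 2) (by positivity)).exists
  refine ⟨(2 ^ k)⁻¹, by positivity, fun y hy => ?_⟩
  rw [Real.dist_eq, abs_lt] at hy ⊢
  have h1 := treeCdf_sub_le hc hsub (hγ k) (x := x) (y := y) (by linarith)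
  have h2 := treeCdf_sub_le hc hsub (hγ k) (x := y) (y := x) (by linarith)
  constructor <;> linarith

end TreeMass

/-- A capacity on the dyadic cells which is subadditive and tends uniformly to zero dominates a
measure with the same total mass. -/
lemma exists_measure_le_of_subadditive {c : ℕ → ℕ → ℝ} (hc : ∀ k i, 0 ≤ c k i)
    (hsub : ∀ k i, c k i ≤ c (k + 1) (2 * i) + c (k + 1) (2 * i + 1)) {γ : ℕ → ℝ}
    (hγ : ∀ k i, c k i ≤ γ k) (hγ0 : Tendsto γ atTop (𝓝 0)) :
    ∃ μ : Measure UnitAddCircle, μ univ = ENNReal.ofReal (c 0 0) ∧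
      ∀ k, ∀ i < 2 ^ k, μ (circleCell (2 ^ k) i) ≤ ENNReal.ofReal (c k i) := by
  have hcont := continuous_treeCdf hc hsub hγ hγ0
  let st : StieltjesFunction ℝ :=
    ⟨treeCdf c, treeCdf_mono hc hsub, fun x => hcont.continuousWithinAt⟩
  have hst : ∀ a b, st.measure (Ico a b) = ENNReal.ofReal (treeCdf c b - treeCdf c a) := by
    intro a b
    have : ∀ x, Function.leftLim st x = treeCdf c x := fun x =>
      ContinuousWithinAt.leftLim_eq (f := treeCdf c) hcont.continuousWithinAt
    rw [StieltjesFunction.measure_Ico, this, this]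
  have hmk : Measurable fun t : ℝ => (t : UnitAddCircle) := AddCircle.measurable_mk'
  have hcell : ∀ k, ∀ i < 2 ^ k, ((st.measure.restrict (Ico 0 1)).map
      fun t : ℝ => (t : UnitAddCircle)) (circleCell (2 ^ k) i)
        = ENNReal.ofReal (treeMass c k i) := by
    intro k i hi
    have h2 : (0 : ℝ) < 2 ^ k := by positivity
    rw [Measure.map_apply hmk (measurableSet_circleCell (by positivity) i),
      Measure.restrict_apply (hmk (measurableSet_circleCell (by positivity) i))]
    have : (fun t : ℝ => (t : UnitAddCircle)) ⁻¹' circleCell (2 ^ k) i ∩ Ico 0 1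
        = Ico ((i : ℝ) / 2 ^ k) (((i + 1 : ℕ) : ℝ) / 2 ^ k) := by
      ext t
      rw [circleCell_eq_of_lt hi]
      simp only [mem_inter_iff, mem_preimage, mem_ofPred_eq, cellIndex, circleRep_coe, mem_Ico,
        div_le_iff₀ h2, lt_div_iff₀ h2]
      constructor
      · rintro ⟨h, ht⟩
        rw [Int.fract_eq_self.2 ht, Nat.floor_eq_iff (by have := ht.1; positivity)] at h
        push_cast at h ⊢
        rw [mul_comm t]
        exact h
      · rintro ⟨h3, h4⟩
        have hi' : ((i + 1 : ℕ) : ℝ) ≤ 2 ^ k := by exact_mod_cast hi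
        have ht : 0 ≤ t ∧ t < 1 := by
          constructor
          · by_contra! hneg
            have : (0 : ℝ) ≤ i := by positivity
            nlinarith
          · nlinarith
        refine ⟨?_, ht⟩
        rw [Int.fract_eq_self.2 ht, Nat.floor_eq_iff (by have := ht.1; positivity)]
        push_cast at h4 ⊢
        rw [mul_comm _ t]
        exact ⟨h3, h4⟩
    rw [this, hst, treeCdf_dyadic hc hsub, treeCdf_dyadic hc hsub, Finset.sum_range_succ,
      add_sub_cancel_left]
  refine ⟨_, ?_, fun k i hi => (hcell k i hi).le.trans
    (ENNReal.ofReal_le_ofReal (treeMass_le hc hsub k i))⟩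
  have h0 := hcell 0 0 (by norm_num)
  have hu : circleCell (2 ^ 0) 0 = univ := by
    rw [circleCell_eq_of_lt (by norm_num)]
    refine eq_univ_of_forall fun x => ?_
    have := cellIndex_lt (q := 2 ^ 0) (by norm_num) x
    simp only [mem_ofPred_eq]; omega
  rwa [hu] at h0

lemma circleCell_eq_union_double (k i : ℕ) :
    circleCell (2 ^ k) i =
      circleCell (2 ^ (k + 1)) (2 * i) ∪ circleCell (2 ^ (k + 1)) (2 * i + 1) := by
  rw [circleCell, circleCell, circleCell, ← image_union]
  congr 1
  push_cast
  rw [show (2 * (i : ℝ)) / 2 ^ (k + 1) = i / 2 ^ k by rw [pow_succ]; field_simp,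
    show (2 * (i : ℝ) + 1 + 1) / 2 ^ (k + 1) = (i + 1) / 2 ^ k by rw [pow_succ]; field_simp; ring]
  refine (Ico_union_Ico_eq_Ico ?_ ?_).symm
  · rw [div_le_div_iff₀ (by positivity) (by positivity), pow_succ]
    nlinarith [pow_pos (two_pos (α := ℝ)) k]
  · rw [div_le_div_iff₀ (by positivity) (by positivity), pow_succ]
    nlinarith [pow_pos (two_pos (α := ℝ)) k]

/-! ### Gauge functions, Hausdorff content and Frostman's lemma. -/

lemma IsGauge.nonneg {g : ℝ → ℝ} (hg : IsGauge g) {x : ℝ} (hx : 0 ≤ x) : 0 ≤ g x := by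
  have h0 := (hg.eq_zero_iff 0 le_rfl).2 rfl
  exact h0 ▸ hg.mono (mem_Ici.2 le_rfl) (mem_Ici.2 hx) hx

lemma IsGauge.pos {g : ℝ → ℝ} (hg : IsGauge g) {x : ℝ} (hx : 0 < x) : 0 < g x :=
  lt_of_le_of_ne (hg.nonneg hx.le) fun h => hx.ne' ((hg.eq_zero_iff x hx.le).1 h.symm)

lemma IsGauge.le {g : ℝ → ℝ} (hg : IsGauge g) {x y : ℝ} (hx : 0 ≤ x) (hxy : x ≤ y) : g x ≤ g y :=
  hg.mono (mem_Ici.2 hx) (mem_Ici.2 (hx.trans hxy)) hxy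

lemma IsGauge.tendsto_pow {g : ℝ → ℝ} (hg : IsGauge g) :
    Tendsto (fun k : ℕ => g ((2 : ℝ)⁻¹ ^ k)) atTop (𝓝 0) := by
  have h0 := (hg.eq_zero_iff 0 le_rfl).2 rfl
  have h1 := hg.rightCont 0 le_rfl
  rw [ContinuousWithinAt, h0] at h1
  refine h1.comp (tendsto_nhdsWithin_iff.2
    ⟨tendsto_pow_atTop_nhds_zero_of_lt_one (by norm_num) (by norm_num), ?_⟩)
  exact Eventually.of_forall fun k => mem_Ici.2 (by positivity)

/-- The Hausdorff content associated with a gauge function. -/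
noncomputable def gaugeContent (g : ℝ → ℝ) (hg : IsGauge g) : OuterMeasure UnitAddCircle :=
  OuterMeasure.ofFunction (fun s => ENNReal.ofReal (g (Metric.ediam s).toReal))
    (by simp [(hg.eq_zero_iff 0 le_rfl).2 rfl])

lemma gaugeContent_circleCell_le {g : ℝ → ℝ} (hg : IsGauge g) (k i : ℕ) :
    gaugeContent g hg (circleCell (2 ^ k) i) ≤ ENNReal.ofReal (g ((2 : ℝ)⁻¹ ^ k)) := by
  refine (OuterMeasure.ofFunction_le _).trans (ENNReal.ofReal_le_ofReal ?_)
  refine hg.le ENNReal.toReal_nonneg (ENNReal.toReal_le_of_le_ofReal (by positivity) ?_)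
  have := ediam_circleCell_le (2 ^ k) i
  simpa using this

/-- A cover whose gauge sum is below `g δ` consists of sets of diameter at most `δ`, because `g` is
monotone and positive off zero. Hence null content forces null measure. The content is preferred to
the measure because it is finite and bounded by the gauge on each cell. -/
lemma gaugeContent_pos {g : ℝ → ℝ} (hg : IsGauge g) {G : Set UnitAddCircle}
    (hG : 0 < hausdorffGauge g G) : 0 < gaugeContent g hg G := by
  rw [pos_iff_ne_zero] at hG ⊢
  contrapose! hG
  rw [← nonpos_iff_eq_zero, hausdorffGauge, Measure.mkMetric_apply]
  refine iSup₂_le fun δ hδ => ?_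
  refine le_of_forall_pos_le_add fun ε hε => ?_
  rw [zero_add]
  obtain ⟨η, hη0, hηδ, hηε⟩ : ∃ η : ℝ≥0∞, 0 < η ∧
      (∀ s : Set UnitAddCircle, ENNReal.ofReal (g (Metric.ediam s).toReal) < η →
        Metric.ediam s ≤ δ) ∧ η ≤ ε := by
    rcases eq_or_ne δ ∞ with rfl | hδt
    · exact ⟨ε, hε, fun _ _ => le_top, le_rfl⟩
    · have hδ0 : 0 < δ.toReal := ENNReal.toReal_pos hδ.ne' hδt
      refine ⟨min (ENNReal.ofReal (g δ.toReal)) ε,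
        lt_min (ENNReal.ofReal_pos.2 (hg.pos hδ0)) hε, fun s hs => ?_, min_le_right _ _⟩
      by_contra! hlt
      have hfin : Metric.ediam s ≠ ∞ := by
        have := Metric.isBounded_of_compactSpace (s := s)
        exact this.ediam_ne_top
      refine absurd (hs.trans_le (min_le_left _ _)) (not_lt.2 (ENNReal.ofReal_le_ofReal ?_))
      exact hg.le hδ0.le (ENNReal.toReal_mono hfin hlt.le)
  have h0 : gaugeContent g hg G < η := hG ▸ hη0
  rw [gaugeContent, OuterMeasure.ofFunction_apply] at h0
  simp only [iInf_lt_iff] at h0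
  obtain ⟨t, hcov, ht⟩ := h0
  refine (iInf₂_le t hcov).trans ((iInf_le _ fun n => ?_).trans ?_)
  · exact hηδ _ ((ENNReal.le_tsum n).trans_lt ht)
  · refine le_trans (ENNReal.tsum_le_tsum fun n => ?_) (ht.le.trans hηε)
    exact iSup_le fun _ => le_rfl

/-- Frostman's lemma on the circle. -/
lemma exists_frostman_measure {g : ℝ → ℝ} (hg : IsGauge g) {G : Set UnitAddCircle}
    (hGc : IsClosed G) (hG : 0 < hausdorffGauge g G) :
    ∃ μ : Measure UnitAddCircle, IsFiniteMeasure μ ∧ 0 < μ univ ∧ μ Gᶜ = 0 ∧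
      ∀ k i, μ (circleCell (2 ^ k) i) ≤ ENNReal.ofReal (g ((2 : ℝ)⁻¹ ^ k)) := by
  set M := gaugeContent g hg
  have hMle : ∀ k i, M (G ∩ circleCell (2 ^ k) i) ≤ ENNReal.ofReal (g ((2 : ℝ)⁻¹ ^ k)) :=
    fun k i => (M.mono inter_subset_right).trans (gaugeContent_circleCell_le hg k i)
  have hfin : ∀ k i, M (G ∩ circleCell (2 ^ k) i) ≠ ∞ :=
    fun k i => ((hMle k i).trans_lt ENNReal.ofReal_lt_top).ne
  let c : ℕ → ℕ → ℝ := fun k i => (M (G ∩ circleCell (2 ^ k) i)).toReal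
  have hcM : ∀ k i, ENNReal.ofReal (c k i) = M (G ∩ circleCell (2 ^ k) i) :=
    fun k i => ENNReal.ofReal_toReal (hfin k i)
  obtain ⟨μ, hμ1, hμ⟩ := exists_measure_le_of_subadditive (c := c)
    (fun k i => ENNReal.toReal_nonneg)
    (fun k i => by
      rw [← ENNReal.toReal_add (hfin _ _) (hfin _ _)]
      refine ENNReal.toReal_mono (ENNReal.add_ne_top.2 ⟨hfin _ _, hfin _ _⟩) ?_
      rw [circleCell_eq_union_double, inter_union_distrib_left]
      exact measure_union_le _ _)
    (γ := fun k => g ((2 : ℝ)⁻¹ ^ k))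
    (fun k i => ENNReal.toReal_le_of_le_ofReal (hg.nonneg (by positivity)) (hMle k i))
    hg.tendsto_pow
  have hμ' : ∀ k i, μ (circleCell (2 ^ k) i) ≤ M (G ∩ circleCell (2 ^ k) i) := by
    intro k i
    have h2 : 0 < 2 ^ k := by positivity
    have e : circleCell (2 ^ k) i = circleCell (2 ^ k) (i % 2 ^ k) := by
      rw [circleCell_eq h2, circleCell_eq h2, Nat.mod_mod]
    rw [e, ← hcM]
    exact hμ k _ (Nat.mod_lt _ h2)
  refine ⟨μ, ⟨by rw [hμ1]; exact ENNReal.ofReal_lt_top⟩, ?_, ?_,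
    fun k i => (hμ' k i).trans (hMle k i)⟩
  · have hu : circleCell (2 ^ 0) 0 = univ := by
      rw [circleCell_eq_of_lt (by norm_num)]
      refine eq_univ_of_forall fun x => ?_
      have := cellIndex_lt (q := 2 ^ 0) (by norm_num) x
      simp only [mem_ofPred_eq]; omega
    rw [hμ1, hcM, hu, inter_univ]
    exact gaugeContent_pos hg hG
  -- Every point off the closed set `G` lies in a dyadic cell disjoint from `G`, to which the
  -- capacity gives zero mass.
  · have hsub : Gᶜ ⊆ ⋃ p : {p : ℕ × ℕ // G ∩ circleCell (2 ^ p.1) p.2 = ∅},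
        circleCell (2 ^ p.1.1) p.1.2 := by
      intro x hx
      obtain ⟨ε, hε, hball⟩ := Metric.isOpen_iff.1 hGc.isOpen_compl x hx
      obtain ⟨k, hk⟩ := exists_pow_lt_of_lt_one hε (by norm_num : (2 : ℝ)⁻¹ < 1)
      have hxm := mem_circleCell_cellIndex (q := 2 ^ k) (by positivity) x
      refine mem_iUnion.2 ⟨⟨(k, cellIndex (2 ^ k) x), ?_⟩, hxm⟩
      refine eq_empty_of_forall_notMem fun y hy => hball ?_ hy.1
      have := dist_lt_of_mem_circleCell hy.2 hxm
      rw [Metric.mem_ball]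
      refine this.trans ?_
      push_cast
      rwa [one_div, ← inv_pow]
    refine measure_mono_null hsub (measure_iUnion_null fun p => ?_)
    rw [← nonpos_iff_eq_zero]
    refine (hμ' _ _).trans ?_
    rw [p.2]; simp

/-! ### The mass distribution principle. -/

lemma hausdorffGauge_countable {h : ℝ → ℝ} (hh : IsGauge h) {D : Set UnitAddCircle}
    (hD : D.Countable) : hausdorffGauge h D = 0 := by
  have h0 := (hh.eq_zero_iff 0 le_rfl).2 rfl
  rw [← biUnion_of_singleton D]
  refine (measure_biUnion_null_iff hD).2 fun x _ => ?_
  rw [← nonpos_iff_eq_zero, hausdorffGauge, Measure.mkMetric_apply]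
  refine iSup₂_le fun δ _ => ?_
  refine (iInf₂_le (fun _ => {x}) (subset_iUnion (fun _ : ℕ => ({x} : Set UnitAddCircle)) 0)).trans
    ((iInf_le _ fun n => by simp).trans ?_)
  simp [h0]

/-- If a ball has radius less than `1`, then its measure is controlled by the gauge function. -/
lemma measure_ball_le {h : ℝ → ℝ} (hh : IsGauge h) {ν : Measure UnitAddCircle} {A : ℝ≥0∞}
    (hν : ∀ k i, ν (circleCell (2 ^ k) i) ≤ A * ENNReal.ofReal (h ((2 : ℝ)⁻¹ ^ k)))
    (x : UnitAddCircle) {d : ℝ} (hd0 : 0 < d) (hd : d < 1) :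
    ν (Metric.ball x d) ≤ 5 * A * ENNReal.ofReal (h d) := by
  obtain ⟨k, hk1, hk2⟩ := exists_nat_pow_near_of_lt_one hd0 hd.le
    (by norm_num : (0 : ℝ) < 2⁻¹) (by norm_num)
  obtain ⟨n, hn⟩ := ball_subset_iUnion_circleCell (q := 2 ^ (k + 1)) (by positivity) hd.le
    (by
      push_cast
      calc (2 : ℝ) ^ (k + 1) * d ≤ 2 ^ (k + 1) * 2⁻¹ ^ k := by gcongr
        _ = 2 := by rw [inv_pow, pow_succ]; field_simp) x
  calc ν (Metric.ball x d) ≤ ∑ e ∈ Finset.range 5, ν (circleCell (2 ^ (k + 1)) (n + e)) :=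
        (measure_mono hn).trans (measure_biUnion_finset_le _ _)
    _ ≤ ∑ e ∈ Finset.range 5, A * ENNReal.ofReal (h d) := by
        refine Finset.sum_le_sum fun e _ => (hν _ _).trans ?_
        gcongr
        exact hh.le (by positivity) hk1.le
    _ = 5 * A * ENNReal.ofReal (h d) := by simp [mul_assoc]

/-- A mass distribution principle along a decreasing sequence of compact sets. -/
lemma hausdorffGauge_iInter_pos {h : ℝ → ℝ} (hh : IsGauge h) {K : ℕ → Set UnitAddCircle}
    (hK : ∀ i, IsCompact (K i)) (hanti : Antitone K) {ν : ℕ → Measure UnitAddCircle}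
    (hνK : ∀ i, ν i (K i)ᶜ = 0) {c A : ℝ≥0∞} (hc : 0 < c) (hA : A ≠ ∞)
    (hνc : ∀ i, c < ν i univ)
    (hν : ∀ i k j, ν i (circleCell (2 ^ k) j) ≤ A * ENNReal.ofReal (h ((2 : ℝ)⁻¹ ^ k)))
    {D : Set UnitAddCircle} (hD : D.Countable) : 0 < hausdorffGauge h ((⋂ i, K i) \ D) := by
  rw [pos_iff_ne_zero]
  intro hzero
  have hzero' : hausdorffGauge h (⋂ i, K i) = 0 :=
    measure_mono_null (fun x hx => by
      by_cases hxD : x ∈ D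
      · exact Or.inr hxD
      · exact Or.inl ⟨hx, hxD⟩)
      (measure_union_null hzero (hausdorffGauge_countable hh hD))
  -- One share `c'` bounds the gauge sum of the cover, the other the errors made in enlarging its
  -- members to open balls.
  obtain ⟨c', hc'0, hc'⟩ : ∃ c' : ℝ≥0∞, 0 < c' ∧ 5 * A * (c' + c') ≤ c := by
    rcases eq_or_ne c ∞ with rfl | hct
    · exact ⟨1, one_pos, le_top⟩
    refine ⟨c / (5 * A + 1) / 2, ?_, ?_⟩
    · refine ENNReal.div_pos (ENNReal.div_pos hc.ne' ?_).ne' (by simp)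
      exact ENNReal.add_ne_top.2 ⟨ENNReal.mul_ne_top (by simp) hA, by simp⟩
    · rw [ENNReal.add_halves]
      calc 5 * A * (c / (5 * A + 1)) ≤ (5 * A + 1) * (c / (5 * A + 1)) := by
            gcongr; exact le_self_add
        _ ≤ c := ENNReal.mul_div_le
  rw [hausdorffGauge, Measure.mkMetric_apply] at hzero'
  have h1 := (le_iSup₂_of_le (f := fun (r : ℝ≥0∞) (_ : 0 < r) =>
    ⨅ (t : ℕ → Set UnitAddCircle) (_ : (⋂ i, K i) ⊆ iUnion t) (_ : ∀ n, Metric.ediam (t n) ≤ r),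
      ∑' n, ⨆ _ : (t n).Nonempty, ENNReal.ofReal (h (Metric.ediam (t n)).toReal))
    (ENNReal.ofReal (1 / 2)) (by simp) le_rfl).trans hzero'.le
  have h2 := h1.trans_lt hc'0
  simp only [iInf_lt_iff] at h2
  obtain ⟨t, hcov, hdiam, hsum⟩ := h2
  obtain ⟨ε, hε0, hεsum⟩ := ENNReal.exists_pos_sum_of_countable hc'0.ne' ℕ
  have hU : ∀ n, ∃ U : Set UnitAddCircle, IsOpen U ∧ t n ⊆ U ∧ ∀ i, ν i U ≤
      5 * A * ((⨆ _ : (t n).Nonempty, ENNReal.ofReal (h (Metric.ediam (t n)).toReal)) + ε n) := by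
    intro n
    rcases (t n).eq_empty_or_nonempty with he | ⟨x, hx⟩
    · exact ⟨∅, isOpen_empty, he.subset, fun i => by simp⟩
    set d := (Metric.ediam (t n)).toReal with hd
    have hd0 : 0 ≤ d := ENNReal.toReal_nonneg
    have hd1 : d ≤ 1 / 2 := ENNReal.toReal_le_of_le_ofReal (by norm_num) (hdiam n)
    have hrc := hh.rightCont d hd0
    -- Right-continuity of the gauge allows a slightly larger radius, which makes the covering sets
    -- open.
    have hev : ∀ᶠ y in 𝓝[>] d, h y < h d + ε n :=
      (hrc.mono_left (nhdsWithin_mono _ Ioi_subset_Ici_self)).eventually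
        (gt_mem_nhds (by have : (0 : ℝ) < ε n := by exact_mod_cast hε0 n
                         linarith))
    obtain ⟨d', hd'1, hd'2⟩ := (hev.and (Ioo_mem_nhdsGT (show d < 1 by linarith))).exists
    refine ⟨Metric.ball x d', Metric.isOpen_ball, fun y hy => ?_, fun i => ?_⟩
    · rw [Metric.mem_ball]
      refine lt_of_le_of_lt ?_ hd'2.1
      rw [dist_edist]
      exact ENNReal.toReal_mono (Metric.isBounded_of_compactSpace).ediam_ne_top
        (Metric.edist_le_ediam_of_mem hy hx)
    · refine (measure_ball_le hh (hν i) x (hd0.trans_lt hd'2.1) hd'2.2).trans ?_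
      have hne : (t n).Nonempty := ⟨x, hx⟩
      simp only [hne, iSup_pos]
      gcongr
      refine (ENNReal.ofReal_le_ofReal hd'1.le).trans ?_
      rw [ENNReal.ofReal_add (hh.nonneg hd0) (by positivity)]
      simp
  choose U hUo htU hUν using hU
  have hsub : (⋂ i, K i) ⊆ ⋃ n, U n := hcov.trans (iUnion_mono htU)
  -- By compactness the open cover of the intersection already covers some `K i`, so `ν i` gives the
  -- contradiction and no limit measure is needed.
  obtain ⟨i, hi⟩ := exists_subset_nhds_of_isCompact hanti.directed_ge hK
    (fun x hx => (isOpen_iUnion hUo).mem_nhds (hsub hx))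
  have : ν i univ ≤ c := by
    calc ν i univ ≤ ν i (K i) + ν i (K i)ᶜ := by
          rw [← union_compl_self (K i)]; exact measure_union_le _ _
      _ ≤ ∑' n, ν i (U n) := by
          rw [hνK, add_zero]; exact (measure_mono hi).trans (measure_iUnion_le _)
      _ ≤ ∑' n, 5 * A * ((⨆ _ : (t n).Nonempty,
            ENNReal.ofReal (h (Metric.ediam (t n)).toReal)) + ε n) :=
          ENNReal.tsum_le_tsum fun n => hUν n i
      _ ≤ 5 * A * (c' + c') := by
          rw [ENNReal.tsum_mul_left, ENNReal.tsum_add]; gcongr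
      _ ≤ c := hc'
  exact absurd (hνc i) (not_lt.2 this)

/-! ### Moments for independent uniform cell indices. -/

/-- The mean of `a` over `{0, …, m - 1}`. -/
noncomputable def cellMean (m : ℕ) (a : ℕ → ℝ) : ℝ := (∑ k ∈ Finset.range m, a k) / m

/-- The mean of `F` over all the families of indices `c` with `c i < q i`. -/
noncomputable def cellAvg {ι : Type*} [Fintype ι] [DecidableEq ι] (q : ι → ℕ)
    (F : (ι → ℕ) → ℝ) : ℝ :=
  (∑ c ∈ Fintype.piFinset fun i => Finset.range (q i), F c) / ∏ i, (q i : ℝ)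

section CellAvg

variable {ι : Type*} [Fintype ι] [DecidableEq ι] {q : ι → ℕ}

lemma cellMean_nonneg {m : ℕ} {a : ℕ → ℝ} (ha : ∀ k, 0 ≤ a k) : 0 ≤ cellMean m a :=
  div_nonneg (Finset.sum_nonneg fun k _ => ha k) (Nat.cast_nonneg _)

lemma cellMean_const_mul (m : ℕ) (t : ℝ) (a : ℕ → ℝ) :
    cellMean m (fun k => t * a k) = t * cellMean m a := by
  rw [cellMean, cellMean, ← Finset.mul_sum, mul_div_assoc]

lemma cellMean_one {m : ℕ} (hm : 0 < m) : cellMean m (fun _ => 1) = 1 := by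
  have : (m : ℝ) ≠ 0 := by exact_mod_cast hm.ne'
  simp [cellMean, this]

lemma cellMean_ite {m k : ℕ} (hk : k < m) : cellMean m (fun l => if k = l then 1 else 0) = 1 / m := by
  rw [cellMean, Finset.sum_ite_eq, if_pos (Finset.mem_range.2 hk)]

lemma cellAvg_prod (f : ι → ℕ → ℝ) :
    cellAvg q (fun c => ∏ i, f i (c i)) = ∏ i, cellMean (q i) (f i) := by
  simp only [cellAvg, cellMean, Finset.prod_div_distrib]
  rw [Finset.prod_univ_sum]

lemma cellAvg_single (hq : ∀ i, 0 < q i) (n : ι) (a : ℕ → ℝ) :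
    cellAvg q (fun c => a (c n)) = cellMean (q n) a := by
  have h1 : (fun c : ι → ℕ => a (c n)) = fun c => ∏ i, (if i = n then a (c i) else 1) := by
    funext c; simp
  rw [h1, cellAvg_prod fun i k => if i = n then a k else 1]
  rw [Finset.prod_eq_single n _ (by simp)]
  · simp
  · intro i _ hi; simp [hi, cellMean_one (hq i)]

lemma cellAvg_pair (hq : ∀ i, 0 < q i) {n m : ι} (hnm : n ≠ m) (a b : ℕ → ℝ) :
    cellAvg q (fun c => a (c n) * b (c m)) = cellMean (q n) a * cellMean (q m) b := by
  have h1 : (fun c : ι → ℕ => a (c n) * b (c m)) =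
      fun c => ∏ i, ((if i = n then a (c i) else 1) * (if i = m then b (c i) else 1)) := by
    funext c; rw [Finset.prod_mul_distrib]; simp
  rw [h1, cellAvg_prod fun i k => (if i = n then a k else 1) * (if i = m then b k else 1)]
  have h2 : ∀ i, cellMean (q i) (fun k => (if i = n then a k else 1) * (if i = m then b k else 1))
      = (if i = n then cellMean (q i) a else 1) * (if i = m then cellMean (q i) b else 1) := by
    intro i
    by_cases hn : i = n
    · subst hn; simp [hnm]
    · by_cases hm : i = m
      · subst hm; simp [hn]
      · simp [hn, hm, cellMean_one (hq i)]
  rw [Finset.prod_congr rfl fun i _ => h2 i, Finset.prod_mul_distrib]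
  simp

lemma cellAvg_sum {κ : Type*} (s : Finset κ) (F : κ → (ι → ℕ) → ℝ) :
    cellAvg q (fun c => ∑ j ∈ s, F j c) = ∑ j ∈ s, cellAvg q (F j) := by
  simp only [cellAvg]
  rw [Finset.sum_comm, Finset.sum_div]

lemma cellAvg_add (F F' : (ι → ℕ) → ℝ) :
    cellAvg q (fun c => F c + F' c) = cellAvg q F + cellAvg q F' := by
  simp only [cellAvg, Finset.sum_add_distrib, add_div]

lemma cellAvg_const_mul (t : ℝ) (F : (ι → ℕ) → ℝ) :
    cellAvg q (fun c => t * F c) = t * cellAvg q F := by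
  simp only [cellAvg, ← Finset.mul_sum, mul_div_assoc]

lemma cellAvg_const (hq : ∀ i, 0 < q i) (t : ℝ) : cellAvg q (fun _ => t) = t := by
  have h := cellAvg_prod (q := q) (fun _ _ => 1)
  have h2 := cellAvg_const_mul (q := q) t (fun _ => 1)
  simp only [Finset.prod_const_one, fun i => cellMean_one (hq i)] at h
  simpa [h] using h2

/-- Distinct coordinates are independent under the uniform average, so only the diagonal terms
differ from the product of the means. -/
lemma cellAvg_sum_mul_sum (hq : ∀ i, 0 < q i) (a b : ι → ℕ → ℝ) :
    cellAvg q (fun c => (∑ i, a i (c i)) * ∑ i, b i (c i)) =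
      (∑ i, cellMean (q i) (a i)) * (∑ i, cellMean (q i) (b i)) +
        ∑ i, (cellMean (q i) (fun k => a i k * b i k) -
          cellMean (q i) (a i) * cellMean (q i) (b i)) := by
  simp only [Finset.sum_mul_sum]
  rw [cellAvg_sum, ← Finset.sum_add_distrib]
  refine Finset.sum_congr rfl fun n _ => ?_
  rw [cellAvg_sum]
  have : ∀ m, cellAvg q (fun c => a n (c n) * b m (c m)) =
      cellMean (q n) (a n) * cellMean (q m) (b m) + if n = m then
        (cellMean (q n) (fun k => a n k * b n k) -
          cellMean (q n) (a n) * cellMean (q n) (b n)) else 0 := by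
    intro m
    by_cases h : n = m
    · subst h
      rw [cellAvg_single hq n fun k => a n k * b n k]; simp
    · rw [cellAvg_pair hq h]; simp [h]
  simp only [this]
  rw [Finset.sum_add_distrib, Finset.sum_ite_eq, if_pos (Finset.mem_univ _)]

lemma cellAvg_sum_mul_sum_le (hq : ∀ i, 0 < q i) {a b : ι → ℕ → ℝ} (ha : ∀ i k, 0 ≤ a i k)
    (hb : ∀ i k, 0 ≤ b i k) :
    cellAvg q (fun c => (∑ i, a i (c i)) * ∑ i, b i (c i)) ≤
      (∑ i, cellMean (q i) (a i)) * (∑ i, cellMean (q i) (b i)) +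
        ∑ i, cellMean (q i) (fun k => a i k * b i k) := by
  rw [cellAvg_sum_mul_sum hq]
  gcongr with i
  exact sub_le_self _ (mul_nonneg (cellMean_nonneg (ha i)) (cellMean_nonneg (hb i)))

lemma cellAvg_variance_le (hq : ∀ i, 0 < q i) (a : ι → ℕ → ℝ) :
    cellAvg q (fun c => (∑ i, a i (c i) - ∑ i, cellMean (q i) (a i)) ^ 2) ≤
      ∑ i, cellMean (q i) (fun k => a i k ^ 2) := by
  set μ := ∑ i, cellMean (q i) (a i) with hμ
  have h1 : (fun c : ι → ℕ => (∑ i, a i (c i) - μ) ^ 2) = fun c =>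
      ((∑ i, a i (c i)) * ∑ i, a i (c i)) + ((-2 * μ) * (∑ i, a i (c i)) + μ ^ 2) := by
    funext c; ring
  have h2 : cellAvg q (fun c => ∑ i, a i (c i)) = μ := by
    rw [cellAvg_sum]
    exact Finset.sum_congr rfl fun i _ => cellAvg_single hq i (a i)
  rw [h1, cellAvg_add, cellAvg_add, cellAvg_const_mul, cellAvg_const hq, h2,
    cellAvg_sum_mul_sum hq, ← hμ, Finset.sum_sub_distrib]
  have h3 : 0 ≤ ∑ i, cellMean (q i) (a i) * cellMean (q i) (a i) :=
    Finset.sum_nonneg fun i _ => mul_self_nonneg _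
  simp only [pow_two]
  nlinarith

end CellAvg

/-! ### Comparison of the law of the cells with the independent one. -/

/-- The indices of the cells that contain the first points of the sequence. -/
noncomputable def cellIndices (r : ℕ → ℝ) (x : ℕ → UnitAddCircle) (M : ℕ) : Fin M → ℕ :=
  fun i => cellIndex ⌈1 / r i⌉₊ (x i)

section Dependence

variable {Ω : Type*} [MeasurableSpace Ω] {P : Measure Ω} {X : ℕ → Ω → UnitAddCircle}
  {r : ℕ → ℝ}

/-- This is the finiteness of `Θ` applied to one sequence of cells, each of measure at most `1 / q`.
The summand `1` takes care of `M = 0`, a case which the ratios defining `Θ` do not include. -/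
lemma measure_cellIndices_eq_le [IsProbabilityMeasure P] (hX : ∀ n, Measurable (X n))
    (hXunif : ∀ n, Measure.map (X n) P = volume) (hr : ∀ n, 0 < r n)
    (hΘ : maxDependenceRatio P X (cellSequences r) < ∞) {M : ℕ} (c : Fin M → ℕ) :
    P {ω | cellIndices r (fun n => X n ω) M = c} ≤
      (maxDependenceRatio P X (cellSequences r) + 1) * ∏ i : Fin M, (⌈1 / r i⌉₊ : ℝ≥0∞)⁻¹ := by
  have hq : ∀ n, 0 < ⌈1 / r n⌉₊ := fun n => Nat.ceil_pos.2 (one_div_pos.2 (hr n))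
  by_cases hc : ∀ i : Fin M, c i < ⌈1 / r i⌉₊
  swap
  · have : {ω | cellIndices r (fun n => X n ω) M = c} = ∅ := by
      refine eq_empty_of_forall_notMem fun ω hω => hc fun i => ?_
      have h := congrFun (show cellIndices r (fun n => X n ω) M = c from hω) i
      rw [← h]
      exact cellIndex_lt (hq i) _
    simp [this]
  rcases M with _ | M
  · simp only [Finset.univ_eq_empty, Finset.prod_empty, mul_one]
    exact prob_le_one.trans le_add_self
  let k : ℕ → ℕ := fun n => if hn : n < M + 1 then c ⟨n, hn⟩ else 0
  let B : ℕ → Set UnitAddCircle := fun n => circleCell ⌈1 / r n⌉₊ (k n)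
  have hk : ∀ n, k n < ⌈1 / r n⌉₊ := fun n => by
    by_cases hn : n < M + 1
    · simp only [k, hn, dif_pos]; exact hc ⟨n, hn⟩
    · simp only [k, hn, dif_neg, not_false_eq_true]; exact hq n
  have hB : B ∈ cellSequences r := ⟨k, hk, fun n => rfl⟩
  have h1 : P {ω | ∀ i ≤ M, X i ω ∈ B i} / ∏ i ∈ Finset.range (M + 1), P {ω | X i ω ∈ B i} ≤
      maxDependenceRatio P X (cellSequences r) :=
    le_trans (le_iSup (fun n : ℕ => P {ω | ∀ i ≤ n, X i ω ∈ B i} /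
      ∏ i ∈ Finset.range (n + 1), P {ω | X i ω ∈ B i}) M)
      (le_iSup₂_of_le (f := fun B (_ : B ∈ cellSequences r) => dependenceRatio P X B) B hB le_rfl)
  have hne : ∏ i ∈ Finset.range (M + 1), P {ω | X i ω ∈ B i} ≠ ∞ :=
    ENNReal.prod_ne_top fun i _ => measure_ne_top _ _
  rw [ENNReal.div_le_iff_le_mul (Or.inr hΘ.ne) (Or.inl hne)] at h1
  have hsub : {ω | cellIndices r (fun n => X n ω) (M + 1) = c} ⊆
      {ω | ∀ i ≤ M, X i ω ∈ B i} := by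
    intro ω hω i hi
    have h := congrFun (show cellIndices r (fun n => X n ω) (M + 1) = c from hω)
      ⟨i, Nat.lt_succ_of_le hi⟩
    have hk' : k i = cellIndex ⌈1 / r i⌉₊ (X i ω) := by
      simp only [k, Nat.lt_succ_of_le hi, dif_pos]; exact h.symm
    simp only [B, hk']
    exact mem_circleCell_cellIndex (hq i) _
  refine (measure_mono hsub).trans (h1.trans ?_)
  gcongr
  · exact le_self_add
  rw [Finset.prod_range]
  refine Finset.prod_le_prod' fun i _ => ?_
  have hm : MeasurableSet (B i) := measurableSet_circleCell (hq i) _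
  have : P {ω | X i ω ∈ B i} = volume (B i) := by
    rw [← hXunif i, Measure.map_apply (hX i) hm]; rfl
  rw [this]
  exact volume_circleCell_le (hq i) _

/-- A Markov inequality for functionals of the cells. -/
lemma measure_le_cellAvg [IsProbabilityMeasure P] (hX : ∀ n, Measurable (X n))
    (hXunif : ∀ n, Measure.map (X n) P = volume) (hr : ∀ n, 0 < r n)
    (hΘ : maxDependenceRatio P X (cellSequences r) < ∞) {M : ℕ} {R : (Fin M → ℕ) → ℝ}
    (hR : ∀ c, 0 ≤ R c) {η : ℝ} (hη : 0 < η) :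
    P {ω | η ≤ R (cellIndices r (fun n => X n ω) M)} ≤
      (maxDependenceRatio P X (cellSequences r) + 1) *
        ENNReal.ofReal (cellAvg (fun i : Fin M => ⌈1 / r i⌉₊) R / η) := by
  have hq : ∀ n, 0 < ⌈1 / r n⌉₊ := fun n => Nat.ceil_pos.2 (one_div_pos.2 (hr n))
  set Θ := maxDependenceRatio P X (cellSequences r) + 1
  set S := Fintype.piFinset fun i : Fin M => Finset.range ⌈1 / r i⌉₊ with hS
  set T := S.filter fun c => η ≤ R c with hT
  have hsub : {ω | η ≤ R (cellIndices r (fun n => X n ω) M)} ⊆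
      ⋃ c ∈ T, {ω | cellIndices r (fun n => X n ω) M = c} := by
    intro ω hω
    refine mem_iUnion₂.2 ⟨cellIndices r (fun n => X n ω) M, ?_, rfl⟩
    rw [hT, Finset.mem_filter]
    refine ⟨?_, hω⟩
    rw [hS, Fintype.mem_piFinset]
    exact fun i => Finset.mem_range.2 (cellIndex_lt (hq i) _)
  have hpos : ∀ i : Fin M, (0 : ℝ) < (⌈1 / r i⌉₊ : ℝ) := fun i => by exact_mod_cast hq i
  have hprod : ∏ i : Fin M, (⌈1 / r i⌉₊ : ℝ≥0∞)⁻¹ =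
      ENNReal.ofReal (∏ i : Fin M, (⌈1 / r i⌉₊ : ℝ)⁻¹) := by
    rw [ENNReal.ofReal_prod_of_nonneg fun i _ => by positivity]
    refine Finset.prod_congr rfl fun i _ => ?_
    rw [ENNReal.ofReal_inv_of_pos (hpos i), ENNReal.ofReal_natCast]
  calc P {ω | η ≤ R (cellIndices r (fun n => X n ω) M)}
      ≤ ∑ c ∈ T, P {ω | cellIndices r (fun n => X n ω) M = c} :=
        (measure_mono hsub).trans (measure_biUnion_finset_le _ _)
    _ ≤ ∑ c ∈ T, Θ * ∏ i : Fin M, (⌈1 / r i⌉₊ : ℝ≥0∞)⁻¹ :=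
        Finset.sum_le_sum fun c _ => measure_cellIndices_eq_le hX hXunif hr hΘ c
    _ = Θ * ENNReal.ofReal (T.card * ∏ i : Fin M, (⌈1 / r i⌉₊ : ℝ)⁻¹) := by
        rw [Finset.sum_const, nsmul_eq_mul, hprod, ENNReal.ofReal_mul (Nat.cast_nonneg _),
          ENNReal.ofReal_natCast]
        ring
    _ ≤ _ := by
        gcongr
        rw [cellAvg, Finset.prod_inv_distrib, ← div_eq_mul_inv, div_right_comm]
        refine div_le_div_of_nonneg_right ?_ (Finset.prod_nonneg fun i _ => (hpos i).le)
        rw [le_div_iff₀ hη]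
        calc (T.card : ℝ) * η = ∑ c ∈ T, η := by simp
          _ ≤ ∑ c ∈ T, R c := Finset.sum_le_sum fun c hc => (Finset.mem_filter.1 hc).2
          _ ≤ ∑ c ∈ S, R c :=
            Finset.sum_le_sum_of_subset_of_nonneg (Finset.filter_subset _ _) fun c _ _ => hR c

end Dependence

/-! ### Random weighted covers and their second moments. -/

section Cover

variable {ι : Type*} [Fintype ι]

/-- The weighted number of cells of indices `c` that contain a point. -/
noncomputable def cover (q : ι → ℕ) (v : ι → ℝ) (c : ι → ℕ) (x : UnitAddCircle) : ℝ :=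
  ∑ i, v i * if cellIndex (q i) x = c i then 1 else 0

/-- The integral over `V` of the weighted number of cells. -/
noncomputable def coverMass (ν : Measure UnitAddCircle) (q : ι → ℕ) (v : ι → ℝ) (c : ι → ℕ)
    (V : Set UnitAddCircle) : ℝ :=
  ∑ i, v i * ν.real (V ∩ {x | cellIndex (q i) x = c i})

variable {ν : Measure UnitAddCircle} [IsFiniteMeasure ν] {q : ι → ℕ} {v : ι → ℝ}

lemma cover_nonneg (hv : ∀ i, 0 ≤ v i) (c : ι → ℕ) (x : UnitAddCircle) : 0 ≤ cover q v c x :=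
  Finset.sum_nonneg fun _ _ => mul_nonneg (hv _) (by split_ifs <;> norm_num)

lemma cover_le (hv : ∀ i, 0 ≤ v i) (c : ι → ℕ) (x : UnitAddCircle) : cover q v c x ≤ ∑ i, v i :=
  Finset.sum_le_sum fun _ _ => mul_le_of_le_one_right (hv _) (by split_ifs <;> norm_num)

lemma measurable_cover (q : ι → ℕ) (v : ι → ℝ) (c : ι → ℕ) : Measurable (cover q v c) :=
  Finset.measurable_sum _ fun _ _ =>
    (Measurable.ite (measurableSet_cellIndex_eq _ _) measurable_const measurable_const).const_mul _

lemma integrable_cellIndex_ite (μ : Measure UnitAddCircle) [IsFiniteMeasure μ] (q k : ℕ) :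
    Integrable (fun x => if cellIndex q x = k then (1 : ℝ) else 0) μ :=
  (integrable_indicator_iff (measurableSet_cellIndex_eq q k)).2
    (integrable_const (1 : ℝ)).integrableOn |>.congr (ae_of_all _ fun x => by
      by_cases h : cellIndex q x = k <;> simp [indicator, h])

lemma integral_cellIndex_ite (μ : Measure UnitAddCircle) [IsFiniteMeasure μ] (q k : ℕ) :
    ∫ x, (if cellIndex q x = k then (1 : ℝ) else 0) ∂μ = μ.real {x | cellIndex q x = k} := by
  have : (fun x => if cellIndex q x = k then (1 : ℝ) else 0) =
      indicator {x | cellIndex q x = k} 1 := by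
    funext x
    by_cases h : cellIndex q x = k <;> simp [indicator, h]
  rw [this, integral_indicator_one (measurableSet_cellIndex_eq q k)]

lemma integrable_cover (μ : Measure UnitAddCircle) [IsFiniteMeasure μ] (q : ι → ℕ) (v : ι → ℝ)
    (c : ι → ℕ) : Integrable (cover q v c) μ :=
  integrable_finsetSum _ fun i _ => (integrable_cellIndex_ite μ (q i) (c i)).const_mul _

lemma setIntegral_cover (c : ι → ℕ) (V : Set UnitAddCircle) :
    ∫ x in V, cover q v c x ∂ν = coverMass ν q v c V := by
  simp only [cover, coverMass]
  rw [integral_finsetSum _ fun i _ => (integrable_cellIndex_ite _ (q i) (c i)).const_mul _]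
  refine Finset.sum_congr rfl fun i _ => ?_
  rw [integral_const_mul, integral_cellIndex_ite,
    measureReal_restrict_apply (measurableSet_cellIndex_eq _ _), inter_comm]

lemma sum_measureReal_inter_cellIndex {p : ℕ} (hp : 0 < p) (V : Set UnitAddCircle) :
    ∑ k ∈ Finset.range p, ν.real (V ∩ {x | cellIndex p x = k}) = ν.real V := by
  have hU : V = ⋃ k ∈ Finset.range p, V ∩ {x | cellIndex p x = k} := by
    ext x
    simp only [mem_iUnion, Finset.mem_range, mem_inter_iff, mem_ofPred_eq, exists_prop]
    exact ⟨fun h => ⟨_, cellIndex_lt hp x, h, rfl⟩, fun ⟨_, _, h, _⟩ => h⟩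
  have h := measureReal_restrict_apply_univ (μ := ν) V
  rw [← h]
  have h2 : (univ : Set UnitAddCircle) = ⋃ k ∈ Finset.range p, {x | cellIndex p x = k} := by
    ext x
    simp only [mem_iUnion, Finset.mem_range, mem_ofPred_eq, exists_prop, mem_univ, true_iff]
    exact ⟨_, cellIndex_lt hp x, rfl⟩
  rw [h2, measureReal_biUnion_finset]
  · refine Finset.sum_congr rfl fun k _ => ?_
    rw [measureReal_restrict_apply (measurableSet_cellIndex_eq _ _), inter_comm]
  · intro k _ l _ hkl
    exact disjoint_left.2 fun x (hx : _ = _) (hx' : _ = _) => hkl (hx.symm.trans hx')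
  · exact fun _ _ => measurableSet_cellIndex_eq _ _

lemma cellMean_measureReal {p : ℕ} (hp : 0 < p) (t : ℝ) (V : Set UnitAddCircle) :
    cellMean p (fun k => t * ν.real (V ∩ {x | cellIndex p x = k})) = t / p * ν.real V := by
  rw [cellMean_const_mul, cellMean, sum_measureReal_inter_cellIndex hp]; ring

variable [DecidableEq ι]

/-- The variance of the mass of the cells within `V`. -/
lemma cellAvg_coverMass_variance_le (hq : ∀ i, 0 < q i) (hv : ∀ i, 0 ≤ v i) {β : ι → ℝ}
    (hβ : ∀ i k, v i * ν.real {x | cellIndex (q i) x = k} ≤ β i) (V : Set UnitAddCircle) :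
    cellAvg q (fun c => (coverMass ν q v c V - (∑ i, v i / q i) * ν.real V) ^ 2) ≤
      ∑ i, v i / q i * β i * ν.real V := by
  have h := cellAvg_variance_le hq
    (fun i k => v i * ν.real (V ∩ {x | cellIndex (q i) x = k}))
  have h2 : ∑ i, cellMean (q i) (fun k => v i * ν.real (V ∩ {x | cellIndex (q i) x = k})) =
      (∑ i, v i / q i) * ν.real V := by
    rw [Finset.sum_mul]
    exact Finset.sum_congr rfl fun i _ => cellMean_measureReal (hq i) _ _
  rw [h2] at h
  refine h.trans (Finset.sum_le_sum fun i _ => ?_)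
  have h3 : v i / q i * β i * ν.real V =
      cellMean (q i) (fun k => (v i * β i) * ν.real (V ∩ {x | cellIndex (q i) x = k})) := by
    rw [cellMean_measureReal (hq i)]; ring
  rw [h3]
  refine div_le_div_of_nonneg_right (Finset.sum_le_sum fun k _ => ?_) (Nat.cast_nonneg _)
  have h4 : ν.real (V ∩ {x | cellIndex (q i) x = k}) ≤ ν.real {x | cellIndex (q i) x = k} :=
    measureReal_mono inter_subset_right
  have h5 : 0 ≤ ν.real (V ∩ {x | cellIndex (q i) x = k}) := measureReal_nonneg
  have h6 := (mul_le_mul_of_nonneg_left h4 (hv i)).trans (hβ i k)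
  calc (v i * ν.real (V ∩ {x | cellIndex (q i) x = k})) ^ 2
      = (v i * ν.real (V ∩ {x | cellIndex (q i) x = k})) *
        (v i * ν.real (V ∩ {x | cellIndex (q i) x = k})) := by ring
    _ ≤ β i * (v i * ν.real (V ∩ {x | cellIndex (q i) x = k})) :=
        mul_le_mul_of_nonneg_right h6 (mul_nonneg (hv i) h5)
    _ = _ := by ring

/-- After exchanging average and integral, the product of the means at a point is `∑ u v / q ≤ δ`,
and the diagonal adds at most `∑ u v * (v / q) ≤ δ`. By Markov's inequality this controls the mass
where the count weighted by `u * v` is large. -/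
lemma cellAvg_integral_mul_le (hq : ∀ i, 0 < q i) (hv : ∀ i, 0 ≤ v i)
    (hv1 : ∑ i, v i / q i = 1) {u : ι → ℝ} (hu : ∀ i, 0 ≤ u i) {δ : ℝ}
    (hu1 : ∀ i, u i * v i ≤ δ) (hu2 : ∀ i, u i * v i ≤ δ * v i) :
    cellAvg q (fun c => ∫ x, cover q (fun i => u i * v i) c x * cover q v c x ∂ν) ≤
      2 * δ * ν.real univ := by
  have hint : ∀ c, Integrable (fun x => cover q (fun i => u i * v i) c x * cover q v c x) ν := by
    intro c
    refine (integrable_cover ν q v c).bdd_mul (c := ∑ i, u i * v i)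
      (measurable_cover _ _ _).aestronglyMeasurable (ae_of_all _ fun x => ?_)
    have hn := fun i => mul_nonneg (hu i) (hv i)
    rw [Real.norm_of_nonneg (cover_nonneg hn c x)]
    exact cover_le hn c x
  have hswap : cellAvg q (fun c => ∫ x, cover q (fun i => u i * v i) c x * cover q v c x ∂ν) =
      ∫ x, cellAvg q (fun c => cover q (fun i => u i * v i) c x * cover q v c x) ∂ν := by
    simp only [cellAvg]
    rw [integral_div, integral_finsetSum _ fun c _ => hint c]
  rw [hswap]
  have hpt : ∀ x, cellAvg q (fun c => cover q (fun i => u i * v i) c x * cover q v c x) ≤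
      2 * δ := by
    intro x
    have hite : ∀ (i : ι) (k : ℕ), (0 : ℝ) ≤ if cellIndex (q i) x = k then 1 else 0 :=
      fun i k => by split_ifs <;> norm_num
    refine (cellAvg_sum_mul_sum_le hq
      (a := fun i k => u i * v i * if cellIndex (q i) x = k then 1 else 0)
      (b := fun i k => v i * if cellIndex (q i) x = k then 1 else 0)
      (fun i k => mul_nonneg (mul_nonneg (hu i) (hv i)) (hite i k))
      (fun i k => mul_nonneg (hv i) (hite i k))).trans ?_
    have e1 : ∀ (i : ι) (t : ℝ), cellMean (q i)
        (fun k => t * if cellIndex (q i) x = k then 1 else 0) = t / q i := fun i t => by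
      rw [cellMean_const_mul, cellMean_ite (cellIndex_lt (hq i) x), mul_one_div]
    have e2 : ∀ i, cellMean (q i) (fun k => u i * v i * (if cellIndex (q i) x = k then 1 else 0) *
        (v i * if cellIndex (q i) x = k then 1 else 0)) = u i * v i * (v i / q i) := fun i => by
      rw [← mul_div_assoc, ← e1]
      congr 1
      funext k
      split_ifs <;> ring
    simp only [e1, e2, hv1, mul_one]
    have h1 : ∑ i, u i * v i / q i ≤ δ := by
      calc ∑ i, u i * v i / q i ≤ ∑ i, δ * (v i / q i) := by
            refine Finset.sum_le_sum fun i _ => ?_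
            rw [← mul_div_assoc]
            exact div_le_div_of_nonneg_right (hu2 i) (Nat.cast_nonneg _)
        _ = δ := by rw [← Finset.mul_sum, hv1, mul_one]
    have h2 : ∑ i, u i * v i * (v i / q i) ≤ δ := by
      calc ∑ i, u i * v i * (v i / q i) ≤ ∑ i, δ * (v i / q i) := by
            refine Finset.sum_le_sum fun i _ => ?_
            exact mul_le_mul_of_nonneg_right (hu1 i) (div_nonneg (hv i) (Nat.cast_nonneg _))
        _ = δ := by rw [← Finset.mul_sum, hv1, mul_one]
    linarith
  calc ∫ x, cellAvg q (fun c => cover q (fun i => u i * v i) c x * cover q v c x) ∂ν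
      ≤ ∫ _, 2 * δ ∂ν := by
        refine integral_mono ?_ (integrable_const _) hpt
        simp only [cellAvg]
        exact (integrable_finsetSum _ fun c _ => hint c).div_const _
    _ = 2 * δ * ν.real univ := by rw [integral_const, smul_eq_mul, mul_comm]

end Cover

/-! ### Truncation of the cover measure, scale by scale. -/

/-- A geometric sum truncated at the inverse of `t` is at most twice that inverse. -/
lemma sum_two_pow_mul_le {t : ℝ} (ht : 0 < t) (m : ℕ) :
    ∑ i ∈ Finset.range m, (if t ≤ (2 : ℝ)⁻¹ ^ i then 2 ^ i * t else 0) ≤ 2 := by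
  -- The second bound makes the induction close: when a new term `2 ^ m * t ≤ 1` occurs, the
  -- preceding sum is at most that same term.
  have key : ∀ m : ℕ, ∑ i ∈ Finset.range m, (if t ≤ (2 : ℝ)⁻¹ ^ i then 2 ^ i * t else 0) ≤
      min 2 (2 ^ m * t) := by
    intro m
    induction m with
    | zero => simp [ht.le]
    | succ m ih =>
      rw [Finset.sum_range_succ]
      have h1 := ih.trans (min_le_left _ _)
      have h2 := ih.trans (min_le_right _ _)
      have hp : 0 < 2 ^ m * t := by positivity
      split_ifs with h
      · rw [inv_pow, le_inv_comm₀ ht (by positivity), ← one_div, le_div_iff₀ ht] at h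
        refine le_min (by linarith) ?_
        rw [pow_succ]; linarith
      · rw [add_zero]
        refine le_min h1 (h2.trans ?_)
        rw [pow_succ]; linarith
  exact (key m).trans (min_le_left _ _)

section Refinement

variable {ι : Type*}

/-- The weights of the cells whose size `t`, measured with the gauge, is at most `2 ^ (-i)`. -/
noncomputable def smallWeight (t v : ι → ℝ) (i : ℕ) (n : ι) : ℝ :=
  if t n ≤ (2 : ℝ)⁻¹ ^ i then v n else 0

variable {t v : ι → ℝ}

lemma smallWeight_nonneg (hv : ∀ n, 0 ≤ v n) (i : ℕ) (n : ι) : 0 ≤ smallWeight t v i n := by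
  rw [smallWeight]; split_ifs; exacts [hv n, le_rfl]

lemma smallWeight_le (hv : ∀ n, 0 ≤ v n) (i : ℕ) (n : ι) : smallWeight t v i n ≤ v n := by
  rw [smallWeight]; split_ifs; exacts [le_rfl, hv n]

variable [Fintype ι]

/-- The fluctuation of the mass that the small cells give to a dyadic cell. -/
noncomputable def fluct (ν : Measure UnitAddCircle) (q : ι → ℕ) (t v : ι → ℝ) (κ : ℕ → ℕ)
    (i k : ℕ) (c : ι → ℕ) : ℝ :=
  coverMass ν q (smallWeight t v i) c {x | cellIndex (2 ^ κ i) x = k} -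
    (∑ n, smallWeight t v i n / q n) * ν.real {x | cellIndex (2 ^ κ i) x = k}

/-- The total quadratic fluctuation, weighted by the inverse of the gauge. -/
noncomputable def fluctCost (ν : Measure UnitAddCircle) (q : ι → ℕ) (t v : ι → ℝ) (κ : ℕ → ℕ)
    (m : ℕ) (c : ι → ℕ) : ℝ :=
  ∑ i ∈ Finset.range m, ∑ k ∈ Finset.range (2 ^ κ i), 2 ^ i * fluct ν q t v κ i k c ^ 2

variable {ν : Measure UnitAddCircle} [IsFiniteMeasure ν] {q : ι → ℕ}

/-- A cell of gauge size `t n` contributes at most `v n / q n * δ * t n * ν V` to the variance on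
`V`. Summing over the dyadic cells of one scale replaces `ν V` by the total mass, and the scales at
which the cell is small sum to `∑ 2 ^ i * t n ≤ 2`. -/
lemma cellAvg_fluctCost_le [DecidableEq ι] (hq : ∀ n, 0 < q n) (hv : ∀ n, 0 ≤ v n)
    (hv1 : ∑ n, v n / q n = 1) (ht : ∀ n, 0 < t n) {δ : ℝ} (hδ : 0 ≤ δ)
    (hmass : ∀ n k, v n * ν.real {x | cellIndex (q n) x = k} ≤ δ * t n) (κ : ℕ → ℕ) (m : ℕ) :
    cellAvg q (fluctCost ν q t v κ m) ≤ 2 * δ * ν.real univ := by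
  have h1 : ∀ i k, cellAvg q (fun c => fluct ν q t v κ i k c ^ 2) ≤
      ∑ n, smallWeight t v i n / q n * (δ * t n) *
        ν.real {x | cellIndex (2 ^ κ i) x = k} := fun i k =>
    cellAvg_coverMass_variance_le hq (smallWeight_nonneg hv i) (fun n l =>
      (mul_le_mul_of_nonneg_right (smallWeight_le hv i n) measureReal_nonneg).trans
        (hmass n l)) _
  have h2 : ∀ i, ∑ k ∈ Finset.range (2 ^ κ i), ν.real {x | cellIndex (2 ^ κ i) x = k} =
      ν.real univ := fun i => by
    rw [← sum_measureReal_inter_cellIndex (ν := ν) (p := 2 ^ κ i) (by positivity) univ]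
    simp
  have h3 : cellAvg q (fluctCost ν q t v κ m) ≤ ∑ i ∈ Finset.range m,
      2 ^ i * ∑ n, smallWeight t v i n / q n * (δ * t n) * ν.real univ := by
    unfold fluctCost
    rw [cellAvg_sum]
    refine Finset.sum_le_sum fun i _ => ?_
    rw [cellAvg_sum]
    simp only [cellAvg_const_mul]
    rw [← Finset.mul_sum]
    refine mul_le_mul_of_nonneg_left ?_ (by positivity)
    refine (Finset.sum_le_sum fun k _ => h1 i k).trans_eq ?_
    rw [Finset.sum_comm]
    refine Finset.sum_congr rfl fun n _ => ?_
    rw [← Finset.mul_sum, h2]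
  refine h3.trans ?_
  have h4 : ∑ i ∈ Finset.range m,
      2 ^ i * ∑ n, smallWeight t v i n / q n * (δ * t n) * ν.real univ =
      ∑ n, v n / q n * δ * ν.real univ *
        ∑ i ∈ Finset.range m, (if t n ≤ (2 : ℝ)⁻¹ ^ i then 2 ^ i * t n else 0) := by
    simp only [Finset.mul_sum]
    rw [Finset.sum_comm]
    refine Finset.sum_congr rfl fun n _ => Finset.sum_congr rfl fun i _ => ?_
    rw [smallWeight]
    split_ifs
    · ring
    · simp
  rw [h4]
  calc ∑ n, v n / q n * δ * ν.real univ *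
        ∑ i ∈ Finset.range m, (if t n ≤ (2 : ℝ)⁻¹ ^ i then 2 ^ i * t n else 0)
      ≤ ∑ n, v n / q n * δ * ν.real univ * 2 := by
        refine Finset.sum_le_sum fun n _ => ?_
        refine mul_le_mul_of_nonneg_left (sum_two_pow_mul_le (ht n) m) ?_
        exact mul_nonneg (mul_nonneg (div_nonneg (hv n) (Nat.cast_nonneg _)) hδ)
          measureReal_nonneg
    _ = 2 * δ * ν.real univ := by
        simp only [mul_assoc]
        rw [← Finset.sum_mul, hv1]; ring

/-- The measure whose density is the weighted number of cells. -/
noncomputable def coverMeasure (ν : Measure UnitAddCircle) (q : ι → ℕ) (v : ι → ℝ) (c : ι → ℕ) :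
    Measure UnitAddCircle :=
  ν.withDensity fun x => ENNReal.ofReal (cover q v c x)

omit [IsFiniteMeasure ν] in
lemma coverMeasure_le (hv : ∀ n, 0 ≤ v n) (c : ι → ℕ) :
    coverMeasure ν q v c ≤ ENNReal.ofReal (∑ n, v n) • ν := by
  rw [← withDensity_const]
  exact withDensity_mono (ae_of_all _ fun x => ENNReal.ofReal_le_ofReal (cover_le hv c x))

lemma isFiniteMeasure_coverMeasure (hv : ∀ n, 0 ≤ v n) (c : ι → ℕ) :
    IsFiniteMeasure (coverMeasure ν q v c) :=
  ⟨(coverMeasure_le hv c univ).trans_lt (by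
    rw [Measure.smul_apply, smul_eq_mul]
    exact ENNReal.mul_lt_top ENNReal.ofReal_lt_top (measure_lt_top _ _))⟩

lemma coverMeasure_real (hv : ∀ n, 0 ≤ v n) (c : ι → ℕ) (A : Set UnitAddCircle) :
    (coverMeasure ν q v c).real A = coverMass ν q v c A := by
  rw [← setIntegral_cover, Measure.real, coverMeasure, withDensity_apply',
    integral_eq_lintegral_of_nonneg_ae (ae_of_all _ fun x => cover_nonneg hv c x)
      (measurable_cover q v c).aestronglyMeasurable]

variable {u : ι → ℝ} {U : ℕ → ℝ} {κ : ℕ → ℕ} {s : ℝ} {i₀ : ℕ}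

/-- Where the weighted count of the cells is at most `s`, the large cells contribute little. -/
lemma coverMass_inter_le (hv : ∀ n, 0 ≤ v n)
    (hU : ∀ i, 0 < U i) (hUu : ∀ i n, v n ≠ 0 → (2 : ℝ)⁻¹ ^ i < t n → U i ≤ u n)
    (hu : ∀ n, 0 ≤ u n) (hs : 0 < s)
    {i : ℕ} {V : Set UnitAddCircle} (hV : s * ν.real V ≤ U i * 2⁻¹ ^ i) (c : ι → ℕ) :
    coverMass ν q v c (V ∩ {x | cover q (fun n => u n * v n) c x ≤ s}) ≤
      2⁻¹ ^ i + coverMass ν q (smallWeight t v i) c V := by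
  set L := {x | cover q (fun n => u n * v n) c x ≤ s} with hL
  have hLm : MeasurableSet L := measurable_cover _ _ _ measurableSet_Iic
  -- Each cell that is not small at scale `i` has `u n ≥ U i`, so its weight counts at least `U i`
  -- times in the sum bounded by `s`.
  have hpt : ∀ x ∈ L, cover q v c x ≤ s / U i + cover q (smallWeight t v i) c x := by
    intro x hx
    have h1 : U i * (cover q v c x - cover q (smallWeight t v i) c x) ≤
        cover q (fun n => u n * v n) c x := by
      rw [cover, cover, cover, ← Finset.sum_sub_distrib, Finset.mul_sum]
      refine Finset.sum_le_sum fun n _ => ?_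
      rw [← sub_mul, ← mul_assoc]
      refine mul_le_mul_of_nonneg_right ?_ (by split_ifs <;> norm_num)
      rw [smallWeight]
      split_ifs with h
      · rw [sub_self, mul_zero]; exact mul_nonneg (hu n) (hv n)
      · rw [sub_zero]
        rcases eq_or_ne (v n) 0 with h0 | h0
        · simp [h0]
        · exact mul_le_mul_of_nonneg_right (hUu i n h0 (not_le.1 h)) (hv n)
    have h2 : cover q v c x - cover q (smallWeight t v i) c x ≤ s / U i := by
      rw [le_div_iff₀ (hU i), mul_comm]
      exact h1.trans hx
    linarith
  have h3 : (s / U i) * ν.real V ≤ 2⁻¹ ^ i := by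
    rw [div_mul_eq_mul_div, div_le_iff₀ (hU i), mul_comm (_ ^ i)]
    exact hV
  rw [← setIntegral_cover, inter_comm, ← Measure.restrict_restrict hLm]
  calc ∫ x in L, cover q v c x ∂(ν.restrict V)
      ≤ ∫ x in L, (s / U i + cover q (smallWeight t v i) c x) ∂(ν.restrict V) :=
        setIntegral_mono_on (integrable_cover _ _ _ _)
          ((integrable_const _).add (integrable_cover _ _ _ _)) hLm hpt
    _ ≤ ∫ x, (s / U i + cover q (smallWeight t v i) c x) ∂(ν.restrict V) := by
        refine setIntegral_le_integral ((integrable_const _).add (integrable_cover _ _ _ _))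
          (ae_of_all _ fun x => ?_)
        exact add_nonneg (div_nonneg hs.le (hU i).le)
          (cover_nonneg (smallWeight_nonneg hv i) c x)
    _ = s / U i * ν.real V + coverMass ν q (smallWeight t v i) c V := by
        rw [integral_add (integrable_const _) (integrable_cover _ _ _ _), setIntegral_cover,
          integral_const, measureReal_restrict_apply_univ, smul_eq_mul, mul_comm]
    _ ≤ _ := by linarith

/-- The union of the dyadic cells on which the fluctuation is large. -/
noncomputable def badSet (ν : Measure UnitAddCircle) (q : ι → ℕ) (t v : ι → ℝ) (κ : ℕ → ℕ)
    (i₀ m : ℕ) (c : ι → ℕ) : Set UnitAddCircle :=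
  open Classical in
  ⋃ i ∈ Finset.Ico i₀ m, ⋃ k ∈ (Finset.range (2 ^ κ i)).filter fun k =>
    (2 : ℝ)⁻¹ ^ i < |fluct ν q t v κ i k c|, {x | cellIndex (2 ^ κ i) x = k}

omit [IsFiniteMeasure ν] in
lemma mean_smallWeight_le (hv : ∀ n, 0 ≤ v n) (hv1 : ∑ n, v n / q n = 1) (i : ℕ)
    (V : Set UnitAddCircle) : (∑ n, smallWeight t v i n / q n) * ν.real V ≤ ν.real V := by
  refine mul_le_of_le_one_left measureReal_nonneg (hv1 ▸ Finset.sum_le_sum fun n _ => ?_)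
  exact div_le_div_of_nonneg_right (smallWeight_le hv i n) (Nat.cast_nonneg _)

/-- On a bad cell the large cells and the expected mass contribute at most `2⁻¹ ^ i` each, less than
the fluctuation itself, and a fluctuation `f` with `|f| > 2⁻¹ ^ i` satisfies `|f| ≤ 2 ^ i * f ^ 2`.
-/
lemma coverMass_badSet_inter_le (hv : ∀ n, 0 ≤ v n) (hv1 : ∑ n, v n / q n = 1)
    (hU : ∀ i, 0 < U i) (hUu : ∀ i n, v n ≠ 0 → (2 : ℝ)⁻¹ ^ i < t n → U i ≤ u n)
    (hu : ∀ n, 0 ≤ u n) (hs : 0 < s)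
    (hνU : ∀ i, i₀ ≤ i → ∀ k, s * ν.real {x | cellIndex (2 ^ κ i) x = k} ≤ U i * 2⁻¹ ^ i)
    (hν : ∀ i, i₀ ≤ i → ∀ k, ν.real {x | cellIndex (2 ^ κ i) x = k} ≤ 2⁻¹ ^ i)
    (m : ℕ) (c : ι → ℕ) :
    coverMass ν q v c (badSet ν q t v κ i₀ m c ∩ {x | cover q (fun n => u n * v n) c x ≤ s}) ≤
      3 * fluctCost ν q t v κ m c := by
  classical
  set L := {x | cover q (fun n => u n * v n) c x ≤ s} with hL
  have := isFiniteMeasure_coverMeasure (ν := ν) (q := q) hv c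
  rw [← coverMeasure_real hv]
  have h1 : (coverMeasure ν q v c).real (badSet ν q t v κ i₀ m c ∩ L) ≤
      ∑ i ∈ Finset.Ico i₀ m, ∑ k ∈ (Finset.range (2 ^ κ i)).filter fun k =>
        (2 : ℝ)⁻¹ ^ i < |fluct ν q t v κ i k c|,
        (coverMeasure ν q v c).real ({x | cellIndex (2 ^ κ i) x = k} ∩ L) := by
    rw [badSet]
    simp only [iUnion_inter]
    refine (measureReal_biUnion_finset_le _ _).trans (Finset.sum_le_sum fun i _ => ?_)
    exact measureReal_biUnion_finset_le _ _
  refine h1.trans ?_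
  rw [fluctCost, Finset.mul_sum]
  calc _ ≤ ∑ i ∈ Finset.Ico i₀ m, 3 * ∑ k ∈ Finset.range (2 ^ κ i),
        2 ^ i * fluct ν q t v κ i k c ^ 2 := by
        refine Finset.sum_le_sum fun i hi => ?_
        have hi0 := (Finset.mem_Ico.1 hi).1
        rw [Finset.mul_sum]
        refine (Finset.sum_le_sum fun k hk => ?_).trans
          (Finset.sum_le_sum_of_subset_of_nonneg (Finset.filter_subset _ _)
            fun k _ _ => by positivity)
        have hbad := (Finset.mem_filter.1 hk).2
        rw [coverMeasure_real hv]
        refine (coverMass_inter_le hv hU hUu hu hs (hνU i hi0 k) c).trans ?_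
        have hm := mean_smallWeight_le (ν := ν) (q := q) (t := t) hv hv1 i
          {x | cellIndex (2 ^ κ i) x = k}
        have hf : coverMass ν q (smallWeight t v i) c {x | cellIndex (2 ^ κ i) x = k} =
          fluct ν q t v κ i k c + (∑ n, smallWeight t v i n / q n) *
            ν.real {x | cellIndex (2 ^ κ i) x = k} := by rw [fluct]; ring
        have h4 := hν i hi0 k
        have h5 := le_abs_self (fluct ν q t v κ i k c)
        have h6 : (2 : ℝ)⁻¹ ^ i + coverMass ν q (smallWeight t v i) c
            {x | cellIndex (2 ^ κ i) x = k} ≤ 3 * |fluct ν q t v κ i k c| := by linarith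
        refine h6.trans (mul_le_mul_of_nonneg_left ?_ (by norm_num))
        rw [← sq_abs, pow_two, ← mul_assoc]
        refine le_mul_of_one_le_left (abs_nonneg _) ?_
        calc (1 : ℝ) = 2 ^ i * 2⁻¹ ^ i := by rw [← mul_pow]; norm_num
          _ ≤ _ := by gcongr
    _ ≤ _ := Finset.sum_le_sum_of_subset_of_nonneg
        (fun i hi => Finset.mem_range.2 (Finset.mem_Ico.1 hi).2)
        fun i _ _ => mul_nonneg (by norm_num) (Finset.sum_nonneg fun k _ => by positivity)

/-- The part of the cover measure on which neither the large cells nor the fluctuation of the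
small cells are too heavy. -/
noncomputable def refinedMeasure (ν : Measure UnitAddCircle) (q : ι → ℕ) (t v u : ι → ℝ)
    (κ : ℕ → ℕ) (s : ℝ) (i₀ m : ℕ) (c : ι → ℕ) : Measure UnitAddCircle :=
  (coverMeasure ν q v c).restrict
    ({x | cover q (fun n => u n * v n) c x ≤ s} \ badSet ν q t v κ i₀ m c)

omit [IsFiniteMeasure ν] in
lemma refinedMeasure_le (hv : ∀ n, 0 ≤ v n) (m : ℕ) (c : ι → ℕ) :
    refinedMeasure ν q t v u κ s i₀ m c ≤ ENNReal.ofReal (∑ n, v n) • ν :=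
  Measure.restrict_le_self.trans (coverMeasure_le hv c)

lemma refinedMeasure_real_le (hv : ∀ n, 0 ≤ v n) (m : ℕ) (c : ι → ℕ) (A : Set UnitAddCircle) :
    (refinedMeasure ν q t v u κ s i₀ m c).real A ≤ coverMass ν q v c A := by
  have := isFiniteMeasure_coverMeasure (ν := ν) (q := q) hv c
  rw [← coverMeasure_real hv]
  exact ENNReal.toReal_mono (measure_ne_top _ _) (Measure.restrict_le_self A)

lemma refinedMeasure_notMem (m : ℕ) (c : ι → ℕ) :
    refinedMeasure ν q t v u κ s i₀ m c {x | ∀ n, v n ≠ 0 → cellIndex (q n) x ≠ c n} = 0 := by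
  refine nonpos_iff_eq_zero.1 ((Measure.restrict_le_self _).trans ?_)
  rw [coverMeasure, withDensity_apply']
  refine (nonpos_iff_eq_zero.2 (lintegral_eq_zero_of_ae_eq_zero ?_))
  have hm : MeasurableSet {x | ∀ n, v n ≠ 0 → cellIndex (q n) x ≠ c n} := by
    have : {x | ∀ n, v n ≠ 0 → cellIndex (q n) x ≠ c n} =
        ⋂ n, ⋂ _ : v n ≠ 0, {x | cellIndex (q n) x = c n}ᶜ := by
      ext x; simp
    rw [this]
    exact MeasurableSet.iInter fun n => MeasurableSet.iInter fun _ =>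
      (measurableSet_cellIndex_eq _ _).compl
  refine (ae_restrict_iff' hm).2 (ae_of_all _ fun x hx => ?_)
  have : cover q v c x = 0 := by
    refine Finset.sum_eq_zero fun n _ => ?_
    rcases eq_or_ne (v n) 0 with h | h
    · simp [h]
    · simp [hx n h]
  simp [this]

/-- The mass lost to bad cells is bounded by the fluctuation cost, and the mass lost above the
threshold `s` by Markov's inequality for the cover measure. -/
lemma le_refinedMeasure_univ (hv : ∀ n, 0 ≤ v n) (hv1 : ∑ n, v n / q n = 1)
    (hU : ∀ i, 0 < U i) (hUu : ∀ i n, v n ≠ 0 → (2 : ℝ)⁻¹ ^ i < t n → U i ≤ u n)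
    (hu : ∀ n, 0 ≤ u n) (hs : 0 < s)
    (hνU : ∀ i, i₀ ≤ i → ∀ k, s * ν.real {x | cellIndex (2 ^ κ i) x = k} ≤ U i * 2⁻¹ ^ i)
    (hν : ∀ i, i₀ ≤ i → ∀ k, ν.real {x | cellIndex (2 ^ κ i) x = k} ≤ 2⁻¹ ^ i)
    (m : ℕ) (c : ι → ℕ) :
    coverMass ν q v c univ ≤ (refinedMeasure ν q t v u κ s i₀ m c).real univ +
      3 * fluctCost ν q t v κ m c +
      s⁻¹ * ∫ x, cover q (fun n => u n * v n) c x * cover q v c x ∂ν := by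
  set L := {x | cover q (fun n => u n * v n) c x ≤ s} with hL
  set B := badSet ν q t v κ i₀ m c with hB
  have hLm : MeasurableSet L := measurable_cover _ _ _ measurableSet_Iic
  have := isFiniteMeasure_coverMeasure (ν := ν) (q := q) hv c
  have h1 : (univ : Set UnitAddCircle) ⊆ (L \ B ∪ B ∩ L) ∪ Lᶜ := by
    intro x _
    by_cases hx : x ∈ L
    · by_cases hx' : x ∈ B
      · exact Or.inl (Or.inr ⟨hx', hx⟩)
      · exact Or.inl (Or.inl ⟨hx, hx'⟩)
    · exact Or.inr hx
  have h2 : (coverMeasure ν q v c).real univ ≤ (coverMeasure ν q v c).real (L \ B) +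
      (coverMeasure ν q v c).real (B ∩ L) + (coverMeasure ν q v c).real Lᶜ :=
    (measureReal_mono h1).trans ((measureReal_union_le _ _).trans
      (by gcongr; exact measureReal_union_le _ _))
  have h3 := coverMass_badSet_inter_le (t := t) hv hv1 hU hUu hu hs hνU hν m c
  rw [← coverMeasure_real hv] at h3
  have h4 : (coverMeasure ν q v c).real Lᶜ ≤
      s⁻¹ * ∫ x, cover q (fun n => u n * v n) c x * cover q v c x ∂ν := by
    have hun : ∀ n, 0 ≤ u n * v n := fun n => mul_nonneg (hu n) (hv n)
    have hint : Integrable (fun x => cover q (fun n => u n * v n) c x * cover q v c x) ν := by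
      refine (integrable_cover ν q v c).bdd_mul (c := ∑ i, u i * v i)
        (measurable_cover _ _ _).aestronglyMeasurable (ae_of_all _ fun x => ?_)
      rw [Real.norm_of_nonneg (cover_nonneg hun c x)]
      exact cover_le hun c x
    rw [coverMeasure_real hv, ← setIntegral_cover, ← integral_const_mul]
    calc ∫ x in Lᶜ, cover q v c x ∂ν
        ≤ ∫ x in Lᶜ, s⁻¹ * (cover q (fun n => u n * v n) c x * cover q v c x) ∂ν := by
          refine setIntegral_mono_on (integrable_cover _ _ _ _).integrableOn
            (hint.const_mul _).integrableOn hLm.compl fun x hx => ?_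
          rw [← mul_assoc]
          refine le_mul_of_one_le_left (cover_nonneg hv c x) ?_
          have : s < cover q (fun n => u n * v n) c x := not_le.1 hx
          calc (1 : ℝ) = s⁻¹ * s := (inv_mul_cancel₀ hs.ne').symm
            _ ≤ _ := by gcongr
      _ ≤ _ := setIntegral_le_integral (hint.const_mul _) (ae_of_all _ fun x =>
          mul_nonneg (inv_nonneg.2 hs.le) (mul_nonneg (cover_nonneg hun c x)
            (cover_nonneg hv c x)))
  have h5 : (refinedMeasure ν q t v u κ s i₀ m c).real univ =
      (coverMeasure ν q v c).real (L \ B) := by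
    rw [refinedMeasure, measureReal_restrict_apply_univ]
  rw [← coverMeasure_real hv, h5]
  linarith

/-- On a cell that is kept, the large cells, the expected mass of the small ones and their
fluctuation each contribute at most `2⁻¹ ^ i`. Scales beyond `m` need no removal, as no cell is
small there. -/
lemma refinedMeasure_cell_le (hv : ∀ n, 0 ≤ v n) (hv1 : ∑ n, v n / q n = 1)
    (hU : ∀ i, 0 < U i) (hUu : ∀ i n, v n ≠ 0 → (2 : ℝ)⁻¹ ^ i < t n → U i ≤ u n)
    (hu : ∀ n, 0 ≤ u n) (hs : 0 < s)
    (hνU : ∀ i, i₀ ≤ i → ∀ k, s * ν.real {x | cellIndex (2 ^ κ i) x = k} ≤ U i * 2⁻¹ ^ i)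
    (hν : ∀ i, i₀ ≤ i → ∀ k, ν.real {x | cellIndex (2 ^ κ i) x = k} ≤ 2⁻¹ ^ i)
    {m : ℕ} (hm : ∀ n, (2 : ℝ)⁻¹ ^ m < t n) (c : ι → ℕ) {i : ℕ} (hi : i₀ ≤ i) (k : ℕ) :
    (refinedMeasure ν q t v u κ s i₀ m c).real {x | cellIndex (2 ^ κ i) x = k} ≤
      3 * 2⁻¹ ^ i := by
  have hcm : MeasurableSet {x | cellIndex (2 ^ κ i) x = k} := measurableSet_cellIndex_eq _ _
  have := isFiniteMeasure_coverMeasure (ν := ν) (q := q) hv c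
  rw [refinedMeasure, measureReal_restrict_apply hcm]
  by_cases hbad : (i < m ∧ k < 2 ^ κ i) ∧ (2 : ℝ)⁻¹ ^ i < |fluct ν q t v κ i k c|
  · have he : {x | cellIndex (2 ^ κ i) x = k} ∩
        ({x | cover q (fun n => u n * v n) c x ≤ s} \ badSet ν q t v κ i₀ m c) = ∅ := by
      refine eq_empty_of_forall_notMem fun x hx => hx.2.2 ?_
      refine mem_iUnion₂.2 ⟨i, Finset.mem_Ico.2 ⟨hi, hbad.1.1⟩, mem_iUnion₂.2 ⟨k, ?_, hx.1⟩⟩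
      exact Finset.mem_filter.2 ⟨Finset.mem_range.2 hbad.1.2, hbad.2⟩
    rw [he, measureReal_empty]
    positivity
  · have hfl : |fluct ν q t v κ i k c| ≤ 2⁻¹ ^ i := by
      by_contra! hlt
      refine hbad ⟨⟨?_, ?_⟩, hlt⟩
      · by_contra! him
        have h0 : ∀ n, smallWeight t v i n = 0 := fun n => by
          rw [smallWeight, if_neg]
          refine not_le.2 (lt_of_le_of_lt ?_ (hm n))
          exact pow_le_pow_of_le_one (by norm_num) (by norm_num) him
        have : fluct ν q t v κ i k c = 0 := by simp [fluct, coverMass, h0]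
        rw [this, abs_zero] at hlt
        exact absurd hlt (not_lt.2 (by positivity))
      · by_contra! hk
        have h0 : {x | cellIndex (2 ^ κ i) x = k} = ∅ := by
          refine eq_empty_of_forall_notMem fun x (hx : _ = _) => ?_
          have := cellIndex_lt (q := 2 ^ κ i) (by positivity) x
          omega
        have : fluct ν q t v κ i k c = 0 := by simp [fluct, coverMass, h0]
        rw [this, abs_zero] at hlt
        exact absurd hlt (not_lt.2 (by positivity))
    have h1 : (coverMeasure ν q v c).real ({x | cellIndex (2 ^ κ i) x = k} ∩
        ({x | cover q (fun n => u n * v n) c x ≤ s} \ badSet ν q t v κ i₀ m c)) ≤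
        coverMass ν q v c ({x | cellIndex (2 ^ κ i) x = k} ∩
          {x | cover q (fun n => u n * v n) c x ≤ s}) := by
      rw [← coverMeasure_real hv]
      exact measureReal_mono (inter_subset_inter_right _ sdiff_subset)
    refine h1.trans ((coverMass_inter_le hv hU hUu hu hs (hνU i hi k) c).trans ?_)
    have h2 := mean_smallWeight_le (ν := ν) (q := q) (t := t) hv hv1 i
      {x | cellIndex (2 ^ κ i) x = k}
    have h3 : coverMass ν q (smallWeight t v i) c {x | cellIndex (2 ^ κ i) x = k} =
      fluct ν q t v κ i k c + (∑ n, smallWeight t v i n / q n) *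
        ν.real {x | cellIndex (2 ^ κ i) x = k} := by rw [fluct]; ring
    have h4 := hν i hi k
    have h5 := le_abs_self (fluct ν q t v κ i k c)
    linarith

end Refinement

/-! ### The ratio `g / h` along dyadic scales. -/

section GaugeRatio

variable {g h φ : ℝ → ℝ}

lemma gaugeRatio_pos (hg : IsGauge g) (hh : IsGauge h) (k : ℕ) :
    0 < g ((2 : ℝ)⁻¹ ^ k) / h ((2 : ℝ)⁻¹ ^ k) :=
  div_pos (hg.pos (by positivity)) (hh.pos (by positivity))

lemma IncreasesFaster.tendsto_ratio (hfast : IncreasesFaster φ h g) :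
    Tendsto (fun k : ℕ => g ((2 : ℝ)⁻¹ ^ k) / h ((2 : ℝ)⁻¹ ^ k)) atTop (𝓝 0) := by
  refine hfast.tendsto_zero.comp (tendsto_nhdsWithin_iff.2
    ⟨tendsto_pow_atTop_nhds_zero_of_lt_one (by norm_num) (by norm_num), ?_⟩)
  exact Eventually.of_forall fun k => mem_Ioi.2 (by positivity)

lemma IncreasesFaster.exists_antitone (hfast : IncreasesFaster φ h g) :
    ∃ k₀ : ℕ, ∀ k l, k₀ ≤ k → k ≤ l → g ((2 : ℝ)⁻¹ ^ l) / h ((2 : ℝ)⁻¹ ^ l) ≤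
      g ((2 : ℝ)⁻¹ ^ k) / h ((2 : ℝ)⁻¹ ^ k) := by
  obtain ⟨ε, hε, hmono⟩ := hfast.monotone_near_zero
  obtain ⟨k₀, hk₀⟩ := exists_pow_lt_of_lt_one hε (by norm_num : (2 : ℝ)⁻¹ < 1)
  have hmem : ∀ k, k₀ ≤ k → (2 : ℝ)⁻¹ ^ k ∈ Ioo 0 ε := fun k hk =>
    ⟨by positivity, (pow_le_pow_of_le_one (by norm_num) (by norm_num) hk).trans_lt hk₀⟩
  exact ⟨k₀, fun k l hk hkl => hmono (hmem l (hk.trans hkl)) (hmem k hk)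
    (pow_le_pow_of_le_one (by norm_num) (by norm_num) hkl)⟩

/-- With `u = g / h` eventually decreasing in the level and `b = 1 / φ` increasing, one has `u (k+1)
* b (k+1) ≤ u k * b k + T k`, where `T` is the summable sequence of the hypothesis. So `u * b` is
bounded. -/
lemma IncreasesFaster.exists_bound (hfast : IncreasesFaster φ h g) (hg : IsGauge g)
    (hh : IsGauge h) (hφ : IsGauge φ) :
    ∃ B : ℝ, 0 < B ∧ ∀ k : ℕ, g ((2 : ℝ)⁻¹ ^ k) / h ((2 : ℝ)⁻¹ ^ k) ≤
      B * φ ((2 : ℝ)⁻¹ ^ k) := by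
  obtain ⟨k₀, hanti⟩ := hfast.exists_antitone
  set u : ℕ → ℝ := fun k => g ((2 : ℝ)⁻¹ ^ k) / h ((2 : ℝ)⁻¹ ^ k) with hu
  set b : ℕ → ℝ := fun k => 1 / φ ((2 : ℝ)⁻¹ ^ k) with hb
  have hu0 : ∀ k, 0 < u k := gaugeRatio_pos hg hh
  have hb0 : ∀ k, 0 < b k := fun k => one_div_pos.2 (hφ.pos (by positivity))
  have hbm : ∀ k, b k ≤ b (k + 1) := fun k => one_div_le_one_div_of_le
    (hφ.pos (by positivity)) (hφ.le (by positivity)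
      (pow_le_pow_of_le_one (by norm_num) (by norm_num) (Nat.le_succ k)))
  set T : ℕ → ℝ := fun j => u (j + 1) * (b (j + 1) - b j) with hT
  have hT0 : ∀ j, 0 ≤ T j := fun j => mul_nonneg (hu0 _).le (sub_nonneg.2 (hbm j))
  have hTs : Summable T := hfast.summable
  have key : ∀ l, u (k₀ + l) * b (k₀ + l) ≤
      u k₀ * b k₀ + ∑ j ∈ Finset.range (k₀ + l), T j := by
    intro l
    induction l with
    | zero => simpa using Finset.sum_nonneg fun j _ => hT0 j
    | succ l ih =>
      rw [← add_assoc, Finset.sum_range_succ]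
      have h1 : u (k₀ + l + 1) * b (k₀ + l) ≤ u (k₀ + l) * b (k₀ + l) :=
        mul_le_mul_of_nonneg_right (hanti _ _ (by omega) (by omega)) (hb0 _).le
      have h2 : u (k₀ + l + 1) * b (k₀ + l + 1) = u (k₀ + l + 1) * b (k₀ + l) + T (k₀ + l) := by
        simp only [hT]; ring
      linarith
  have hS : 0 ≤ ∑ k ∈ Finset.range (k₀ + 1), u k * b k :=
    Finset.sum_nonneg fun k _ => (mul_pos (hu0 k) (hb0 k)).le
  have hS' : 0 ≤ ∑' j, T j := tsum_nonneg hT0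
  refine ⟨∑ k ∈ Finset.range (k₀ + 1), u k * b k + ∑' j, T j + 1, by linarith, fun k => ?_⟩
  have hφk : 0 < φ ((2 : ℝ)⁻¹ ^ k) := hφ.pos (by positivity)
  rw [← div_le_iff₀ hφk, div_eq_mul_one_div]
  change u k * b k ≤ _
  rcases le_total k₀ k with hk | hk
  · obtain ⟨l, rfl⟩ := Nat.exists_eq_add_of_le hk
    have h1 := hTs.sum_le_tsum (Finset.range (k₀ + l)) fun j _ => hT0 j
    have h2 : u k₀ * b k₀ ≤ ∑ k ∈ Finset.range (k₀ + 1), u k * b k :=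
      Finset.single_le_sum (f := fun k => u k * b k)
        (fun k _ => (mul_pos (hu0 k) (hb0 k)).le) (Finset.mem_range.2 (by omega))
    linarith [key l]
  · have h2 : u k * b k ≤ ∑ k ∈ Finset.range (k₀ + 1), u k * b k :=
      Finset.single_le_sum (f := fun k => u k * b k)
        (fun k _ => (mul_pos (hu0 k) (hb0 k)).le) (Finset.mem_range.2 (by omega))
    linarith

end GaugeRatio

/-! ### Tame measures and their refinements. -/

lemma cellIndex_two_pow_div {k l : ℕ} (h : k ≤ l) (x : UnitAddCircle) :
    cellIndex (2 ^ k) x = cellIndex (2 ^ l) x / 2 ^ (l - k) := by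
  rw [cellIndex, cellIndex, ← Nat.floor_div_natCast]
  congr 1
  push_cast
  rw [eq_div_iff (by positivity)]
  calc (2 : ℝ) ^ k * circleRep x * 2 ^ (l - k) = (2 ^ k * 2 ^ (l - k)) * circleRep x := by ring
    _ = _ := by rw [← pow_add, Nat.add_sub_cancel' h]

lemma setOf_cellIndex_eq_empty {q k : ℕ} (hq : 0 < q) (hk : q ≤ k) :
    {x | cellIndex q x = k} = ∅ :=
  eq_empty_of_forall_notMem fun x (hx : _ = _) => by
    have := cellIndex_lt hq x
    omega

lemma setOf_cellIndex_one : {x | cellIndex (2 ^ 0) x = 0} = univ :=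
  eq_univ_of_forall fun x => by
    have := cellIndex_lt (q := 2 ^ 0) (by norm_num) x
    simp only [mem_ofPred_eq]; omega

lemma measureReal_cellIndex_eq_le {μ : Measure UnitAddCircle} {g : ℝ → ℝ} (hg : IsGauge g)
    (hμ : ∀ k i, μ (circleCell (2 ^ k) i) ≤ ENNReal.ofReal (g ((2 : ℝ)⁻¹ ^ k))) {q : ℕ}
    (hq : 0 < q) {j : ℕ} (hj : 2 ^ j ≤ 2 * q) (k : ℕ) :
    μ.real {x | cellIndex q x = k} ≤ 3 * g ((2 : ℝ)⁻¹ ^ j) := by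
  have hg0 : 0 ≤ g ((2 : ℝ)⁻¹ ^ j) := hg.nonneg (by positivity)
  rcases lt_or_ge k q with hk | hk
  · rw [← circleCell_eq_of_lt hk]
    obtain ⟨n, hn⟩ := circleCell_subset_iUnion (p := q) (q := 2 ^ j) hq (by positivity) hj k
    refine ENNReal.toReal_le_of_le_ofReal (by positivity) ?_
    calc μ (circleCell q k) ≤ ∑ e ∈ Finset.range 3, μ (circleCell (2 ^ j) (n + e)) :=
          (measure_mono hn).trans (measure_biUnion_finset_le _ _)
      _ ≤ ∑ e ∈ Finset.range 3, ENNReal.ofReal (g ((2 : ℝ)⁻¹ ^ j)) :=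
          Finset.sum_le_sum fun e _ => hμ _ _
      _ = ENNReal.ofReal (3 * g ((2 : ℝ)⁻¹ ^ j)) := by
          rw [ENNReal.ofReal_mul (by norm_num)]; simp
  · rw [setOf_cellIndex_eq_empty hq hk, measureReal_empty]
    positivity

/-- The measures that occur in the construction: they have a bounded density with respect to `μ`,
a total mass above `b`, and their masses on the dyadic cells are controlled by the gauge. -/
structure IsTame (h : ℝ → ℝ) (μ : Measure UnitAddCircle) (b : ℝ)
    (ν : Measure UnitAddCircle) : Prop where
  le : ∃ C : ℝ, 0 < C ∧ ν ≤ ENNReal.ofReal C • μ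
  lower : b < ν.real univ
  cell : ∀ k l : ℕ, ν.real {x | cellIndex (2 ^ k) x = l} < 6 * h ((2 : ℝ)⁻¹ ^ k)

lemma IsTame.isFiniteMeasure {h : ℝ → ℝ} {μ ν : Measure UnitAddCircle} [IsFiniteMeasure μ] {b : ℝ}
    (hν : IsTame h μ b ν) : IsFiniteMeasure ν := by
  obtain ⟨C, _, hC⟩ := hν.le
  exact ⟨(hC univ).trans_lt (by
    rw [Measure.smul_apply, smul_eq_mul]
    exact ENNReal.mul_lt_top ENNReal.ofReal_lt_top (measure_lt_top _ _))⟩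

/-- The measure `ν'` is tame, absolutely continuous with respect to `ν`, and carried by the cells of
indices at least `N`. -/
structure IsRefinement (h : ℝ → ℝ) (μ : Measure UnitAddCircle) (b : ℝ) (q : ℕ → ℕ)
    (N M : ℕ) (c : Fin M → ℕ) (ν ν' : Measure UnitAddCircle) : Prop where
  tame : IsTame h μ b ν'
  ac : ν' ≪ ν
  carried : ν' {x | ∀ n : Fin M, N ≤ n → cellIndex (q n) x ≠ c n} = 0

/-- The refinement when the lengths of the cells do not tend to zero. -/
lemma exists_functional_of_frequently {h : ℝ → ℝ} {μ ν : Measure UnitAddCircle}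
    [IsFiniteMeasure μ] {b : ℝ} (hν : IsTame h μ b ν) {q : ℕ → ℕ} (hq : ∀ n, 0 < q n) {p : ℕ}
    (hp : ∃ᶠ n in atTop, q n = p) (N : ℕ) :
    ∃ η > 0, ∀ δ > 0, ∃ (M : ℕ) (R : (Fin M → ℕ) → ℝ), (∀ c, 0 ≤ R c) ∧
      cellAvg (fun i : Fin M => q i) R ≤ δ ∧
      ∀ c, R c < η → ∃ ν', IsRefinement h μ b q N M c ν ν' := by
  classical
  refine ⟨1, one_pos, fun δ hδ => ?_⟩
  have hp0 : 0 < p := by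
    obtain ⟨n, hn⟩ := hp.exists
    exact hn ▸ hq n
  have hp0' : (0 : ℝ) < p := by exact_mod_cast hp0
  obtain ⟨L, hL0, hL⟩ : ∃ L : ℕ, 0 < L ∧ (p : ℝ) ^ 2 ≤ δ * L := by
    obtain ⟨L, hL⟩ := exists_nat_ge ((p : ℝ) ^ 2 / δ)
    refine ⟨L + 1, by omega, ?_⟩
    rw [div_le_iff₀ hδ] at hL
    push_cast
    nlinarith
  have hinf : {n | q n = p ∧ N ≤ n}.Infinite :=
    Nat.frequently_atTop_iff_infinite.1 (hp.and_eventually (eventually_ge_atTop N))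
  obtain ⟨A, hA, hAc⟩ := hinf.exists_subset_card_eq L
  obtain ⟨M, hM⟩ : ∃ M, ∀ n ∈ A, n < M :=
    ⟨A.sup id + 1, fun n hn => Nat.lt_succ_of_le (Finset.le_sup (f := id) hn)⟩
  set I : Finset (Fin M) := Finset.univ.filter fun i : Fin M => (i : ℕ) ∈ A with hI
  have hIA : I.map Fin.valEmbedding = A := by
    ext n
    simp only [hI, Finset.mem_map, Finset.mem_filter, Finset.mem_univ, true_and,
      Fin.valEmbedding_apply]
    exact ⟨fun ⟨i, hi, e⟩ => e ▸ hi, fun hn => ⟨⟨n, hM n hn⟩, hn, rfl⟩⟩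
  have hIc : (I.card : ℝ) = L := by
    rw [← hAc, ← hIA, Finset.card_map]
  have hIq : ∀ i ∈ I, q i = p ∧ N ≤ (i : ℕ) := fun i hi => hA (Finset.mem_filter.1 hi).2
  let a : ℕ → Fin M → ℕ → ℝ := fun k i l => if i ∈ I then (if k = l then 1 else 0) else 0
  have hmean : ∀ k < p, ∑ i : Fin M, cellMean (q i) (a k i) = L / p := by
    intro k hk
    have h1 : ∀ i : Fin M, cellMean (q i) (a k i) = if i ∈ I then (1 : ℝ) / p else 0 := by
      intro i
      by_cases hi : i ∈ I
      · simp only [a, hi, if_true]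
        rw [(hIq i hi).1, cellMean_ite hk]
      · simp [a, hi, cellMean]
    simp only [h1]
    rw [Finset.sum_ite_mem, Finset.univ_inter, Finset.sum_const, nsmul_eq_mul, hIc, mul_one_div]
  -- Normalized squared deviation of the number of hits of each of the `p` cells: a cell that is
  -- never hit contributes exactly `1`, while the average is at most `p ^ 2 / L`. If every cell is
  -- hit, the circle is covered and `ν` refines itself.
  let R : (Fin M → ℕ) → ℝ := fun c =>
    (p / L : ℝ) ^ 2 * ∑ k ∈ Finset.range p, (∑ i, a k i (c i) - L / p) ^ 2
  have hL0' : (0 : ℝ) < L := by exact_mod_cast hL0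
  refine ⟨M, R, fun c => by positivity, ?_, fun c hc => ⟨ν, hν, Measure.AbsolutelyContinuous.rfl, ?_⟩⟩
  · simp only [R]
    rw [cellAvg_const_mul, cellAvg_sum]
    have h1 : ∀ k ∈ Finset.range p,
        cellAvg (fun i : Fin M => q i) (fun c => (∑ i, a k i (c i) - L / p) ^ 2) ≤ L / p := by
      intro k hk
      have hk' := Finset.mem_range.1 hk
      have h2 := cellAvg_variance_le (q := fun i : Fin M => q i) (fun i => hq i) (a k)
      rw [hmean k hk'] at h2
      refine h2.trans_eq ?_
      rw [← hmean k hk']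
      refine Finset.sum_congr rfl fun i _ => ?_
      congr 1
      funext l
      simp only [a]
      split_ifs <;> norm_num
    calc (p / L : ℝ) ^ 2 * ∑ k ∈ Finset.range p, cellAvg (fun i : Fin M => q i)
          (fun c => (∑ i, a k i (c i) - L / p) ^ 2)
        ≤ (p / L : ℝ) ^ 2 * ∑ k ∈ Finset.range p, (L / p : ℝ) := by
          gcongr with k hk; exact h1 k hk
      _ = (p : ℝ) ^ 2 / L := by
          rw [Finset.sum_const, Finset.card_range, nsmul_eq_mul]; field_simp
      _ ≤ δ := by rw [div_le_iff₀ hL0']; exact hL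
  · have hempty : {x | ∀ n : Fin M, N ≤ n → cellIndex (q n) x ≠ c n} = ∅ := by
      refine eq_empty_of_forall_notMem fun x hx => ?_
      have hk : cellIndex p x < p := cellIndex_lt hp0 x
      have h0 : ∀ i, a (cellIndex p x) i (c i) = 0 := by
        intro i
        by_cases hi : i ∈ I
        · have h1 := hx i (hIq i hi).2
          rw [(hIq i hi).1] at h1
          simp [a, h1]
        · simp [a, hi]
      have h2 : (L / p : ℝ) ^ 2 ≤ ∑ k ∈ Finset.range p, (∑ i, a k i (c i) - L / p) ^ 2 := by
        refine le_trans (le_of_eq ?_) (Finset.single_le_sum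
          (f := fun k => (∑ i, a k i (c i) - L / p : ℝ) ^ 2) (fun k _ => sq_nonneg _)
          (Finset.mem_range.2 hk))
        simp [h0]
      have h3 : 1 ≤ R c := by
        calc (1 : ℝ) = (p / L : ℝ) ^ 2 * (L / p) ^ 2 := by field_simp
          _ ≤ R c := by simp only [R]; gcongr
      exact absurd hc (not_lt.2 h3)
    rw [hempty, measure_empty]

/-- The refinement when the lengths of the cells tend to zero, for a block of cells with normalized
weights: here `j n` is the dyadic scale of the cells of the `n`-th sequence. -/
lemma exists_functional_of_weights {g h : ℝ → ℝ} (hg : IsGauge g) (hh : IsGauge h)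
    (hlim : Tendsto (fun k : ℕ => g ((2 : ℝ)⁻¹ ^ k) / h ((2 : ℝ)⁻¹ ^ k)) atTop (𝓝 0))
    {μ ν : Measure UnitAddCircle} [IsFiniteMeasure μ]
    (hμ : ∀ k i, μ (circleCell (2 ^ k) i) ≤ ENNReal.ofReal (g ((2 : ℝ)⁻¹ ^ k)))
    {b : ℝ} (hν : IsTame h μ b ν) {q : ℕ → ℕ} (hq : ∀ n, 0 < q n) {k₀ : ℕ}
    (hanti : ∀ k l, k₀ ≤ k → k ≤ l → g ((2 : ℝ)⁻¹ ^ l) / h ((2 : ℝ)⁻¹ ^ l) ≤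
      g ((2 : ℝ)⁻¹ ^ k) / h ((2 : ℝ)⁻¹ ^ k)) {j : ℕ → ℕ} (hj : ∀ n, 2 ^ j n ≤ 2 * q n) (N : ℕ)
    (hblock : ∀ δ > 0, ∃ (M : ℕ) (v : Fin M → ℝ), (∀ n, 0 ≤ v n) ∧ ∑ n, v n / q n = 1 ∧
      (∀ n, v n ≠ 0 → N ≤ n ∧ k₀ ≤ j n ∧ g ((2 : ℝ)⁻¹ ^ j n) / h ((2 : ℝ)⁻¹ ^ j n) ≤ δ) ∧
      ∀ n, v n * (g ((2 : ℝ)⁻¹ ^ j n) / h ((2 : ℝ)⁻¹ ^ j n)) ≤ δ) :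
    ∃ η > 0, ∀ δ > 0, ∃ (M : ℕ) (R : (Fin M → ℕ) → ℝ), (∀ c, 0 ≤ R c) ∧
      cellAvg (fun i : Fin M => q i) R ≤ δ ∧
      ∀ c, R c < η → ∃ ν', IsRefinement h μ b q N M c ν ν' := by
  classical
  have hνfin := hν.isFiniteMeasure
  obtain ⟨C, hC0, hCν⟩ := hν.le
  set G : ℕ → ℝ := fun k => g ((2 : ℝ)⁻¹ ^ k) with hG
  set H : ℕ → ℝ := fun k => h ((2 : ℝ)⁻¹ ^ k) with hH
  have hG0 : ∀ k, 0 < G k := fun k => hg.pos (by positivity)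
  have hH0 : ∀ k, 0 < H k := fun k => hh.pos (by positivity)
  have hHanti : ∀ k l, k ≤ l → H l ≤ H k := fun k l hkl =>
    hh.le (by positivity) (pow_le_pow_of_le_one (by norm_num) (by norm_num) hkl)
  have hHlim : Tendsto H atTop (𝓝 0) := hh.tendsto_pow
  have hνμ : ∀ A, ν.real A ≤ C * μ.real A := fun A => by
    have h1 := ENNReal.toReal_mono (by
      rw [Measure.smul_apply, smul_eq_mul]
      exact ENNReal.mul_ne_top ENNReal.ofReal_ne_top (measure_ne_top _ _)) (hCν A)
    rwa [Measure.smul_apply, smul_eq_mul, ENNReal.toReal_mul, ENNReal.toReal_ofReal hC0.le] at h1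
  have hνG : ∀ k l, ν.real {x | cellIndex (2 ^ k) x = l} ≤ C * G k := by
    intro k l
    rcases lt_or_ge l (2 ^ k) with hl | hl
    · refine (hνμ _).trans (mul_le_mul_of_nonneg_left ?_ hC0.le)
      rw [← circleCell_eq_of_lt hl]
      exact ENNReal.toReal_le_of_le_ofReal (hG0 k).le (hμ k l)
    · rw [setOf_cellIndex_eq_empty (by positivity) hl, measureReal_empty]
      exact mul_nonneg hC0.le (hG0 k).le
  have hex : ∀ i : ℕ, ∃ k, H k ≤ (2 : ℝ)⁻¹ ^ i := fun i =>
    ((tendsto_order.1 hHlim).2 _ (by positivity : (0 : ℝ) < 2⁻¹ ^ i)).exists.imp fun _ h => h.le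
  -- Scales are indexed by the size of the gauge: `κ i` is the first dyadic level at which `h` drops
  -- to `2⁻¹ ^ i`.
  set κ : ℕ → ℕ := fun i => Nat.find (hex i) with hκ
  have hκH : ∀ i, H (κ i) ≤ 2⁻¹ ^ i := fun i => Nat.find_spec (hex i)
  have hκle : ∀ i k, H k ≤ 2⁻¹ ^ i → κ i ≤ k := fun i k hk => Nat.find_min' (hex i) hk
  set u : ℕ → ℝ := fun k => G k / H k with hu
  have hu0 : ∀ k, 0 < u k := fun k => div_pos (hG0 k) (hH0 k)
  -- Beyond level `k₁` one has `C * g ≤ h`, so from scale `i₀` on `ν` itself has mass at most `2⁻¹ ^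
  -- i` on cells of level `κ i`.
  obtain ⟨k₁, hk₁⟩ : ∃ k₁, ∀ k, k₁ ≤ k → u k < C⁻¹ :=
    eventually_atTop.1 ((tendsto_order.1 hlim).2 _ (inv_pos.2 hC0))
  obtain ⟨i₀, hi₀⟩ := exists_pow_lt_of_lt_one (hH0 k₁) (by norm_num : (2 : ℝ)⁻¹ < 1)
  have hνU : ∀ i k, C⁻¹ * ν.real {x | cellIndex (2 ^ κ i) x = k} ≤ u (κ i) * 2⁻¹ ^ i := by
    intro i k
    calc C⁻¹ * ν.real {x | cellIndex (2 ^ κ i) x = k} ≤ C⁻¹ * (C * G (κ i)) :=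
          mul_le_mul_of_nonneg_left (hνG _ _) (inv_pos.2 hC0).le
      _ = u (κ i) * H (κ i) := by
          rw [inv_mul_cancel_left₀ hC0.ne', hu, div_mul_cancel₀ _ (hH0 _).ne']
      _ ≤ _ := mul_le_mul_of_nonneg_left (hκH i) (hu0 _).le
  have hν2 : ∀ i, i₀ ≤ i → ∀ k, ν.real {x | cellIndex (2 ^ κ i) x = k} ≤ 2⁻¹ ^ i := by
    intro i hi k
    have h1 : k₁ ≤ κ i := by
      by_contra! hlt
      have h2 := hHanti _ _ hlt.le
      have h3 : (2 : ℝ)⁻¹ ^ i ≤ 2⁻¹ ^ i₀ := pow_le_pow_of_le_one (by norm_num) (by norm_num) hi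
      have h4 := hκH i
      linarith
    have h5 := hνU i k
    have h6 : u (κ i) * (2 : ℝ)⁻¹ ^ i ≤ C⁻¹ * 2⁻¹ ^ i :=
      mul_le_mul_of_nonneg_right (hk₁ _ h1).le (by positivity)
    exact le_of_mul_le_mul_left (h5.trans h6) (inv_pos.2 hC0)
  obtain ⟨K, hK⟩ := hex i₀
  -- The bounds in `IsTame` are strict and only finitely many coarse cells are concerned, so a
  -- margin is available; thus the constants do not deteriorate under refinement.
  obtain ⟨ε, hε0, hεcell, hεuniv⟩ : ∃ ε : ℝ, 0 < ε ∧
      (∀ k ∈ Finset.range (K + 1), ∀ l ∈ Finset.range (2 ^ k),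
        ν.real {x | cellIndex (2 ^ k) x = l} + ε < 6 * H k) ∧ b < ν.real univ - 2 * ε := by
    have e1 : ∀ᶠ ε in 𝓝[>] (0 : ℝ), ∀ k ∈ Finset.range (K + 1), ∀ l ∈ Finset.range (2 ^ k),
        ν.real {x | cellIndex (2 ^ k) x = l} + ε < 6 * H k := by
      refine (Filter.eventually_all_finset _).2 fun k _ =>
        (Filter.eventually_all_finset _).2 fun l _ => ?_
      filter_upwards [Ioo_mem_nhdsGT (sub_pos.2 (hν.cell k l))] with ε hε
      have := hε.2
      simp only [hH]
      linarith
    have e2 : ∀ᶠ ε in 𝓝[>] (0 : ℝ), b < ν.real univ - 2 * ε := by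
      filter_upwards [Ioo_mem_nhdsGT (half_pos (sub_pos.2 hν.lower))] with ε hε
      have := hε.2
      linarith
    obtain ⟨ε, h1, h2, h3⟩ := (e1.and (e2.and self_mem_nhdsWithin)).exists
    exact ⟨ε, h3, h1, h2⟩
  -- The bound `ε` limits the lost mass `R₁ + R₂`; the bound `ε ^ 2` on `R₃` makes each coarse
  -- deviation less than `ε`.
  refine ⟨min ε (ε ^ 2), lt_min hε0 (by positivity), fun δ hδ => ?_⟩
  set T := ν.real univ with hT
  have hT0 : 0 ≤ T := measureReal_nonneg
  set A : ℝ := 3 * (2 * T) + C * (2 * T) + (K + 1) * (H 0 * T) + 1 with hA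
  have hA0 : 0 < A := by have := (hH0 0).le; positivity
  -- The factor `3` counts the dyadic cells that cover a cell of length `1 / q n`; the summand `1`
  -- gives `D ≥ 1`.
  set D : ℝ := 1 + 3 * C with hD
  have hD1 : 1 ≤ D := by simp only [hD]; linarith
  have hD0 : 0 < D := by linarith
  set δ₁ : ℝ := δ / A with hδ₁
  have hδ₁0 : 0 < δ₁ := div_pos hδ hA0
  obtain ⟨M, v, hv, hv1, hvN, hvu⟩ := hblock (δ₁ / D) (div_pos hδ₁0 hD0)
  have hδD : δ₁ / D ≤ δ₁ := div_le_self hδ₁0.le hD1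
  let q' : Fin M → ℕ := fun n => q n
  let t : Fin M → ℝ := fun n => H (j n)
  let u' : Fin M → ℝ := fun n => u (j n)
  have hq' : ∀ n, 0 < q' n := fun n => hq n
  have ht : ∀ n, 0 < t n := fun n => hH0 _
  have hu' : ∀ n, 0 ≤ u' n := fun n => (hu0 _).le
  have hu1 : ∀ n, u' n * v n ≤ δ₁ := fun n => by
    rw [mul_comm]; exact (hvu n).trans hδD
  have hu2 : ∀ n, u' n * v n ≤ δ₁ * v n := fun n => by
    rcases eq_or_ne (v n) 0 with h0 | h0
    · simp [h0]
    · exact mul_le_mul_of_nonneg_right ((hvN n h0).2.2.trans hδD) (hv n)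
  have hmass : ∀ n k, v n * ν.real {x | cellIndex (q' n) x = k} ≤ δ₁ * t n := by
    intro n k
    have h1 : ν.real {x | cellIndex (q' n) x = k} ≤ D * (u' n * t n) := by
      have h2 : u' n * t n = G (j n) := div_mul_cancel₀ _ (hH0 _).ne'
      rw [h2]
      calc ν.real {x | cellIndex (q' n) x = k} ≤ C * (3 * G (j n)) :=
            (hνμ _).trans (mul_le_mul_of_nonneg_left
              (measureReal_cellIndex_eq_le hg hμ (hq n) (hj n) k) hC0.le)
        _ ≤ D * G (j n) := by
            have := (hG0 (j n)).le
            simp only [hD]; nlinarith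
    calc v n * ν.real {x | cellIndex (q' n) x = k} ≤ v n * (D * (u' n * t n)) :=
          mul_le_mul_of_nonneg_left h1 (hv n)
      _ = D * (v n * u' n) * t n := by ring
      _ ≤ D * (δ₁ / D) * t n := by
          have := hvu n
          have h3 := (ht n).le
          gcongr
      _ = δ₁ * t n := by rw [mul_div_cancel₀ _ hD0.ne']
  -- A cell that is large at scale `i` has a dyadic level below `κ i`, where `g / h` is at least as
  -- big.
  have hUu : ∀ i n, v n ≠ 0 → (2 : ℝ)⁻¹ ^ i < t n → u (κ i) ≤ u' n := by
    intro i n h0 hlt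
    refine hanti _ _ (hvN n h0).2.1 ?_
    by_contra! hk
    have h1 := hHanti _ _ hk.le
    have h2 := hκH i
    have : t n = H (j n) := rfl
    linarith
  obtain ⟨m, hm⟩ : ∃ m : ℕ, ∀ n, (2 : ℝ)⁻¹ ^ m < t n := by
    have hev : ∀ᶠ m : ℕ in atTop, ∀ n, (2 : ℝ)⁻¹ ^ m < t n :=
      eventually_all.2 fun n => (tendsto_order.1 (tendsto_pow_atTop_nhds_zero_of_lt_one
        (by norm_num : (0 : ℝ) ≤ 2⁻¹) (by norm_num))).2 _ (ht n)
    exact hev.exists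
  let R₁ : (Fin M → ℕ) → ℝ := fun c => 3 * fluctCost ν q' t v κ m c
  let R₂ : (Fin M → ℕ) → ℝ := fun c =>
    C * ∫ x, cover q' (fun n => u' n * v n) c x * cover q' v c x ∂ν
  let R₃ : (Fin M → ℕ) → ℝ := fun c => ∑ k ∈ Finset.range (K + 1), ∑ l ∈ Finset.range (2 ^ k),
    (coverMass ν q' v c {x | cellIndex (2 ^ k) x = l} -
      (∑ n, v n / q' n) * ν.real {x | cellIndex (2 ^ k) x = l}) ^ 2
  have hR₁0 : ∀ c, 0 ≤ R₁ c := fun c => mul_nonneg (by norm_num)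
    (Finset.sum_nonneg fun i _ => Finset.sum_nonneg fun k _ => by positivity)
  have hR₂0 : ∀ c, 0 ≤ R₂ c := fun c => mul_nonneg hC0.le (integral_nonneg fun x =>
    mul_nonneg (cover_nonneg (fun n => mul_nonneg (hu' n) (hv n)) c x) (cover_nonneg hv c x))
  have hR₃0 : ∀ c, 0 ≤ R₃ c := fun c =>
    Finset.sum_nonneg fun k _ => Finset.sum_nonneg fun l _ => sq_nonneg _
  have hsumT : ∀ k : ℕ, ∑ l ∈ Finset.range (2 ^ k), ν.real {x | cellIndex (2 ^ k) x = l} = T := by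
    intro k
    rw [hT, ← sum_measureReal_inter_cellIndex (ν := ν) (p := 2 ^ k) (by positivity) univ]
    simp
  have hR₁a : cellAvg q' R₁ ≤ 3 * (2 * δ₁ * T) := by
    simp only [R₁]
    rw [cellAvg_const_mul]
    exact mul_le_mul_of_nonneg_left (cellAvg_fluctCost_le hq' hv hv1 ht hδ₁0.le hmass κ m)
      (by norm_num)
  have hR₂a : cellAvg q' R₂ ≤ C * (2 * δ₁ * T) := by
    simp only [R₂]
    rw [cellAvg_const_mul]
    exact mul_le_mul_of_nonneg_left (cellAvg_integral_mul_le hq' hv hv1 hu' hu1 hu2) hC0.le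
  have hR₃a : cellAvg q' R₃ ≤ (K + 1) * (δ₁ * H 0 * T) := by
    simp only [R₃]
    rw [cellAvg_sum]
    have h1 : ∀ k ∈ Finset.range (K + 1), cellAvg q' (fun c => ∑ l ∈ Finset.range (2 ^ k),
        (coverMass ν q' v c {x | cellIndex (2 ^ k) x = l} -
          (∑ n, v n / q' n) * ν.real {x | cellIndex (2 ^ k) x = l}) ^ 2) ≤ δ₁ * H 0 * T := by
      intro k _
      rw [cellAvg_sum]
      calc _ ≤ ∑ l ∈ Finset.range (2 ^ k), ∑ n, v n / q' n * (δ₁ * H 0) *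
            ν.real {x | cellIndex (2 ^ k) x = l} := by
            refine Finset.sum_le_sum fun l _ =>
              cellAvg_coverMass_variance_le hq' hv (fun n k => (hmass n k).trans ?_) _
            exact mul_le_mul_of_nonneg_left (hHanti _ _ (Nat.zero_le _)) hδ₁0.le
        _ = ∑ l ∈ Finset.range (2 ^ k), δ₁ * H 0 * ν.real {x | cellIndex (2 ^ k) x = l} := by
            refine Finset.sum_congr rfl fun l _ => ?_
            rw [← Finset.sum_mul, ← Finset.sum_mul, hv1, one_mul]
        _ = _ := by rw [← Finset.mul_sum, hsumT]
    refine (Finset.sum_le_sum h1).trans_eq ?_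
    rw [Finset.sum_const, Finset.card_range, nsmul_eq_mul]
    push_cast; ring
  refine ⟨M, fun c => R₁ c + (R₂ c + R₃ c),
    fun c => add_nonneg (hR₁0 c) (add_nonneg (hR₂0 c) (hR₃0 c)), ?_, fun c hc => ?_⟩
  · change cellAvg q' _ ≤ δ
    rw [cellAvg_add, cellAvg_add]
    have h1 : 3 * (2 * δ₁ * T) + (C * (2 * δ₁ * T) + (K + 1) * (δ₁ * H 0 * T)) + δ₁ = δ₁ * A := by
      simp only [hA]; ring
    have h2 : δ₁ * A = δ := div_mul_cancel₀ _ hA0.ne'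
    linarith
  · have hdev : ∀ k, k ≤ K → ∀ l < 2 ^ k,
        |coverMass ν q' v c {x | cellIndex (2 ^ k) x = l} -
          ν.real {x | cellIndex (2 ^ k) x = l}| < ε := by
      intro k hk l hl
      refine abs_lt_of_sq_lt_sq ?_ hε0.le
      have h1 : (coverMass ν q' v c {x | cellIndex (2 ^ k) x = l} -
          ν.real {x | cellIndex (2 ^ k) x = l}) ^ 2 ≤ R₃ c := by
        refine le_trans ?_ (Finset.single_le_sum
          (f := fun k => ∑ l ∈ Finset.range (2 ^ k),
            (coverMass ν q' v c {x | cellIndex (2 ^ k) x = l} -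
              (∑ n, v n / q' n) * ν.real {x | cellIndex (2 ^ k) x = l}) ^ 2)
          (fun k _ => Finset.sum_nonneg fun l _ => sq_nonneg _)
          (Finset.mem_range.2 (Nat.lt_succ_of_le hk)))
        refine le_trans (le_of_eq ?_) (Finset.single_le_sum
          (f := fun l => (coverMass ν q' v c {x | cellIndex (2 ^ k) x = l} -
              (∑ n, v n / q' n) * ν.real {x | cellIndex (2 ^ k) x = l}) ^ 2)
          (fun l _ => sq_nonneg _) (Finset.mem_range.2 hl))
        simp only [q', hv1, one_mul]
      have h2 := hc.trans_le (min_le_right _ _)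
      have h3 := hR₁0 c
      have h4 := hR₂0 c
      linarith
    refine ⟨refinedMeasure ν q' t v u' κ C⁻¹ i₀ m c, ⟨?_, ?_, ?_⟩, ?_, ?_⟩
    · refine ⟨max (∑ n, v n) 1 * C, by positivity, (refinedMeasure_le hv m c).trans ?_⟩
      rw [ENNReal.ofReal_mul (by positivity), mul_smul]
      refine Measure.le_iff'.2 fun s => ?_
      have h1 : ENNReal.ofReal (∑ n, v n) ≤ ENNReal.ofReal (max (∑ n, v n) 1) :=
        ENNReal.ofReal_le_ofReal (le_max_left _ _)
      have h2 := hCν s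
      rw [Measure.smul_apply, Measure.smul_apply, smul_eq_mul, smul_eq_mul]
      gcongr
    · have h1 := le_refinedMeasure_univ (ν := ν) (q := q') (t := t) (u := u')
        (U := fun i => u (κ i)) (κ := κ) (i₀ := i₀) hv hv1 (fun i => hu0 _) hUu hu'
        (inv_pos.2 hC0) (fun i _ => hνU i) hν2 m c
      rw [inv_inv] at h1
      have h2 := hdev 0 (Nat.zero_le _) 0 (by norm_num)
      rw [setOf_cellIndex_one] at h2
      have h3 := (abs_lt.1 h2).1
      have h4 := hc.trans_le (min_le_left _ _)
      have h5 := hR₃0 c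
      simp only [R₁, R₂] at h4
      linarith
    · intro k l
      have hfin : IsFiniteMeasure (refinedMeasure ν q' t v u' κ C⁻¹ i₀ m c) := by
        have := isFiniteMeasure_coverMeasure (ν := ν) (q := q') hv c
        rw [refinedMeasure]; infer_instance
      rcases lt_or_ge l (2 ^ k) with hl | hl
      swap
      · rw [setOf_cellIndex_eq_empty (by positivity) hl, measureReal_empty]
        exact mul_pos (by norm_num) (hH0 k)
      rcases le_or_gt (H k) (2⁻¹ ^ i₀) with hki | hki
      -- Fine levels: with `2⁻¹ ^ (i + 1) < H k ≤ 2⁻¹ ^ i`, the enclosing cell of level `κ i` has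
      -- mass at most `3 * 2⁻¹ ^ i < 6 * H k`. This is where the constant `6` comes from.
      · obtain ⟨i, hi1, hi2⟩ := exists_nat_pow_near_of_lt_one (hH0 k)
          (hki.trans (pow_le_one₀ (by norm_num) (by norm_num)))
          (by norm_num : (0 : ℝ) < 2⁻¹) (by norm_num)
        have hi : i₀ ≤ i := by
          by_contra! hlt
          have : (2 : ℝ)⁻¹ ^ i₀ ≤ 2⁻¹ ^ (i + 1) :=
            pow_le_pow_of_le_one (by norm_num) (by norm_num) hlt
          linarith
        have hκk : κ i ≤ k := hκle i k hi2
        have hsub : {x | cellIndex (2 ^ k) x = l} ⊆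
            {x | cellIndex (2 ^ κ i) x = l / 2 ^ (k - κ i)} := fun x (hx : _ = _) => by
          rw [mem_ofPred_eq, cellIndex_two_pow_div hκk, hx]
        have h1 := refinedMeasure_cell_le (ν := ν) (q := q') (t := t) (u := u')
          (U := fun i => u (κ i)) (κ := κ) (i₀ := i₀) hv hv1 (fun i => hu0 _) hUu hu'
          (inv_pos.2 hC0) (fun i _ => hνU i) hν2 hm c hi (l / 2 ^ (k - κ i))
        refine (measureReal_mono hsub).trans_lt (h1.trans_lt ?_)
        rw [pow_succ] at hi1
        simp only [hH] at hi1
        linarith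
      -- Coarse levels: the mass differs by less than `ε` from that of `ν`, which leaves that
      -- margin.
      · have hkK : k ≤ K := by
          by_contra! hlt
          have := hHanti _ _ hlt.le
          linarith
        have h1 := refinedMeasure_real_le (ν := ν) (q := q') (t := t) (u := u') (κ := κ)
          (s := C⁻¹) (i₀ := i₀) hv m c {x | cellIndex (2 ^ k) x = l}
        have h2 := (abs_lt.1 (hdev k hkK l hl)).2
        have h3 := hεcell k (Finset.mem_range.2 (Nat.lt_succ_of_le hkK)) l (Finset.mem_range.2 hl)
        simp only [hH] at h3
        linarith
    · exact Measure.restrict_le_self.absolutelyContinuous.trans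
        (withDensity_absolutelyContinuous _ _)
    · refine measure_mono_null (fun x hx n hn => hx n (hvN n hn).1)
        (refinedMeasure_notMem (ν := ν) (q := q') (v := v) m c)

/-! ### Choice of the weights from the divergent series. -/

section Scales

variable {r : ℕ → ℝ}

lemma ceil_inv_pos (hr : ∀ n, 0 < r n) (n : ℕ) : 0 < ⌈1 / r n⌉₊ :=
  Nat.ceil_pos.2 (one_div_pos.2 (hr n))

lemma one_div_ceil_le (hr : ∀ n, 0 < r n) (n : ℕ) : 1 / (⌈1 / r n⌉₊ : ℝ) ≤ r n := by
  have h0 : (0 : ℝ) < ⌈1 / r n⌉₊ := by exact_mod_cast ceil_inv_pos hr n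
  rw [div_le_comm₀ h0 (hr n)]
  exact Nat.le_ceil _

lemma half_le_one_div_ceil (hr : ∀ n, 0 < r n ∧ r n ≤ 1) (n : ℕ) :
    r n / 2 ≤ 1 / (⌈1 / r n⌉₊ : ℝ) := by
  have h0 : (0 : ℝ) < ⌈1 / r n⌉₊ := by exact_mod_cast ceil_inv_pos (fun n => (hr n).1) n
  have h1 : (⌈1 / r n⌉₊ : ℝ) < 1 / r n + 1 := Nat.ceil_lt_add_one (one_div_pos.2 (hr n).1).le
  have h2 : 1 ≤ 1 / r n := (one_le_div (hr n).1).2 (hr n).2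
  rw [le_div_iff₀ h0]
  calc r n / 2 * ⌈1 / r n⌉₊ ≤ r n / 2 * (2 * (1 / r n)) := by
        have := (hr n).1
        gcongr; linarith
    _ = 1 := by have := (hr n).1.ne'; field_simp

lemma two_pow_clog_le {q : ℕ} (hq : 0 < q) : 2 ^ Nat.clog 2 q ≤ 2 * q := by
  rcases Nat.lt_or_ge 1 q with h | h
  · have h1 := Nat.pow_pred_clog_lt_self one_lt_two h
    have h2 : 0 < Nat.clog 2 q := Nat.clog_pos one_lt_two h
    obtain ⟨m, hm⟩ := Nat.exists_eq_succ_of_ne_zero h2.ne'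
    rw [hm] at h1 ⊢
    simp only [Nat.pred_succ] at h1
    rw [pow_succ]; omega
  · have : q = 1 := by omega
    subst this
    simp

lemma exists_frequently_eq_of_not_tendsto {q : ℕ → ℕ} (h : ¬ Tendsto q atTop atTop) :
    ∃ p, ∃ᶠ n in atTop, q n = p := by
  by_contra! hne
  refine h (tendsto_atTop.2 fun K => ?_)
  have h1 : ∀ᶠ n in atTop, ∀ p ∈ Finset.range K, q n ≠ p :=
    (Filter.eventually_all_finset _).2 fun p _ => hne p
  filter_upwards [h1] with n hn
  by_contra! hlt
  exact hn _ (Finset.mem_range.2 hlt) rfl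

end Scales

/-- Refinements exist outside of an event of arbitrarily small probability. -/
lemma exists_functional {r : ℕ → ℝ} (hr : ∀ n, 0 < r n ∧ r n ≤ 1) {g h φ : ℝ → ℝ}
    (hg : IsGauge g) (hh : IsGauge h) (hφ : IsGauge φ) (hfast : IncreasesFaster φ h g)
    (hdiv : ¬ Summable fun n => r n / φ (r n))
    {μ ν : Measure UnitAddCircle} [IsFiniteMeasure μ]
    (hμ : ∀ k i, μ (circleCell (2 ^ k) i) ≤ ENNReal.ofReal (g ((2 : ℝ)⁻¹ ^ k)))
    {b : ℝ} (hν : IsTame h μ b ν) (N : ℕ) :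
    ∃ η > 0, ∀ δ > 0, ∃ (M : ℕ) (R : (Fin M → ℕ) → ℝ), (∀ c, 0 ≤ R c) ∧
      cellAvg (fun i : Fin M => ⌈1 / r i⌉₊) R ≤ δ ∧
      ∀ c, R c < η → ∃ ν', IsRefinement h μ b (fun n => ⌈1 / r n⌉₊) N M c ν ν' := by
  set q : ℕ → ℕ := fun n => ⌈1 / r n⌉₊ with hqdef
  have hr0 : ∀ n, 0 < r n := fun n => (hr n).1
  have hq : ∀ n, 0 < q n := ceil_inv_pos hr0
  have hq0 : ∀ n, (0 : ℝ) < q n := fun n => by exact_mod_cast hq n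
  by_cases hlim : Tendsto q atTop atTop
  swap
  · obtain ⟨p, hp⟩ := exists_frequently_eq_of_not_tendsto hlim
    exact exists_functional_of_frequently hν hq hp N
  obtain ⟨k₀, hanti⟩ := hfast.exists_antitone
  obtain ⟨B, hB0, hB⟩ := hfast.exists_bound hg hh hφ
  have hjlim : Tendsto (fun n => Nat.clog 2 (q n)) atTop atTop := by
    refine tendsto_atTop.2 fun K => ?_
    filter_upwards [tendsto_atTop.1 hlim (2 ^ K)] with n hn
    exact (Nat.pow_le_pow_iff_right one_lt_two).1 (hn.trans (Nat.le_pow_clog one_lt_two _))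
  refine exists_functional_of_weights hg hh hfast.tendsto_ratio hμ hν hq hanti
    (fun n => two_pow_clog_le (hq n)) N fun δ hδ => ?_
  obtain ⟨N₁, hN₁⟩ : ∃ N₁, ∀ n, N₁ ≤ n → N ≤ n ∧ k₀ ≤ Nat.clog 2 (q n) ∧
      g ((2 : ℝ)⁻¹ ^ Nat.clog 2 (q n)) / h ((2 : ℝ)⁻¹ ^ Nat.clog 2 (q n)) ≤ δ :=
    eventually_atTop.1 ((eventually_ge_atTop N).and ((tendsto_atTop.1 hjlim k₀).and
      (((tendsto_order.1 (hfast.tendsto_ratio.comp hjlim)).2 δ hδ).mono fun _ h => h.le)))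
  -- Since `g / h ≤ B * φ` at the dyadic level of the cell, `w n` times this ratio is at most `B`;
  -- dividing by a partial sum `Λ ≥ B / δ` brings it below `δ`. Partial sums that large exist
  -- because `1 / q n ≥ r n / 2`.
  set w : ℕ → ℝ := fun n => if N₁ ≤ n then 1 / φ (r n) else 0 with hw
  have hφr : ∀ n, 0 < φ (r n) := fun n => hφ.pos (hr0 n)
  have hw0 : ∀ n, 0 ≤ w n := fun n => by
    simp only [hw]; split_ifs
    exacts [(one_div_pos.2 (hφr n)).le, le_rfl]
  have hwq0 : ∀ n, 0 ≤ w n / q n := fun n => div_nonneg (hw0 n) (hq0 n).le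
  have hns : ¬ Summable fun n => w n / q n := by
    intro hs
    have h1 : Summable fun n => 1 / φ (r n) / q n := by
      refine (summable_congr_cofinite ?_).1 hs
      rw [Nat.cofinite_eq_atTop]
      filter_upwards [eventually_ge_atTop N₁] with n hn
      simp only [hw, if_pos hn]
    refine hdiv (Summable.of_nonneg_of_le (fun n => (div_pos (hr0 n) (hφr n)).le) (fun n => ?_)
      (h1.mul_left 2))
    have h2 := half_le_one_div_ceil hr n
    have h3 := (one_div_pos.2 (hφr n)).le
    calc r n / φ (r n) = 2 * (1 / φ (r n) * (r n / 2)) := by ring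
      _ ≤ 2 * (1 / φ (r n) * (1 / (q n : ℝ))) := by gcongr
      _ = 2 * (1 / φ (r n) / q n) := by ring
  have htop := (not_summable_iff_tendsto_nat_atTop_of_nonneg hwq0).1 hns
  obtain ⟨M, hM⟩ := (tendsto_atTop.1 htop (B / δ)).exists
  set Λ := ∑ n ∈ Finset.range M, w n / q n with hΛ
  have hΛ0 : 0 < Λ := (div_pos hB0 hδ).trans_le hM
  refine ⟨M, fun n => w n / Λ, fun n => div_nonneg (hw0 n) hΛ0.le, ?_, fun n hn => ?_,
    fun n => ?_⟩
  · rw [Finset.sum_range] at hΛ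
    simp only [div_right_comm _ Λ]
    rw [← Finset.sum_div, ← hΛ, div_self hΛ0.ne']
  · refine hN₁ n ?_
    by_contra hlt
    exact hn (by simp [hw, hlt])
  · have h1 : w n * (g ((2 : ℝ)⁻¹ ^ Nat.clog 2 (q n)) / h ((2 : ℝ)⁻¹ ^ Nat.clog 2 (q n))) ≤ B := by
      have hle : (2 : ℝ)⁻¹ ^ Nat.clog 2 (q n) ≤ r n := by
        refine le_trans ?_ (one_div_ceil_le hr0 n)
        rw [inv_pow, ← one_div]
        refine one_div_le_one_div_of_le (hq0 n) ?_
        exact_mod_cast Nat.le_pow_clog one_lt_two (q n)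
      have h2 := (hB (Nat.clog 2 (q n))).trans
        (mul_le_mul_of_nonneg_left (hφ.le (by positivity) hle) hB0.le)
      by_cases hn : N₁ ≤ (n : ℕ)
      · simp only [hw, if_pos hn]
        rw [one_div_mul_eq_div, div_le_iff₀ (hφr n)]
        exact h2
      · simp only [hw, if_neg hn, zero_mul]
        exact hB0.le
    rw [div_mul_eq_mul_div, div_le_iff₀ hΛ0]
    refine h1.trans ?_
    rwa [div_le_iff₀ hδ, mul_comm] at hM

/-! ### Almost sure refinement and its iteration. -/

section Construction

variable {Ω : Type*} [MeasurableSpace Ω] {P : Measure Ω} [IsProbabilityMeasure P]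
  {X : ℕ → Ω → UnitAddCircle} {r : ℕ → ℝ} {g h φ : ℝ → ℝ}

/-- Almost surely, a given tame measure has a refinement. -/
lemma ae_exists_isRefinement (hX : ∀ n, Measurable (X n))
    (hXunif : ∀ n, Measure.map (X n) P = volume) (hr : ∀ n, 0 < r n ∧ r n ≤ 1)
    (hg : IsGauge g) (hh : IsGauge h) (hφ : IsGauge φ) (hfast : IncreasesFaster φ h g)
    (hΘ : maxDependenceRatio P X (cellSequences r) < ∞)
    (hdiv : ¬ Summable fun n => r n / φ (r n))
    {μ ν : Measure UnitAddCircle} [IsFiniteMeasure μ]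
    (hμ : ∀ k i, μ (circleCell (2 ^ k) i) ≤ ENNReal.ofReal (g ((2 : ℝ)⁻¹ ^ k)))
    {b : ℝ} (hν : IsTame h μ b ν) (N : ℕ) :
    ∀ᵐ ω ∂P, ∃ M ν', IsRefinement h μ b (fun n => ⌈1 / r n⌉₊) N M
      (cellIndices r (fun n => X n ω) M) ν ν' := by
  obtain ⟨η, hη, hR⟩ := exists_functional hr hg hh hφ hfast hdiv hμ hν N
  rw [ae_iff]
  set S := {ω | ¬ ∃ M ν', IsRefinement h μ b (fun n => ⌈1 / r n⌉₊) N M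
      (cellIndices r (fun n => X n ω) M) ν ν'} with hS
  set Θ := maxDependenceRatio P X (cellSequences r)
  -- The threshold `η` does not depend on `δ`, so the bound tends to zero with `δ`.
  have hle : ∀ δ : ℝ, 0 < δ → P S ≤ (Θ + 1) * ENNReal.ofReal (δ / η) := by
    intro δ hδ
    obtain ⟨M, R, hR0, hRavg, hRref⟩ := hR δ hδ
    have hsub : S ⊆ {ω | η ≤ R (cellIndices r (fun n => X n ω) M)} := fun ω hω => by
      by_contra hlt
      obtain ⟨ν', hν'⟩ := hRref _ (not_le.1 hlt)
      exact hω ⟨M, ν', hν'⟩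
    refine (measure_mono hsub).trans
      ((measure_le_cellAvg hX hXunif (fun n => (hr n).1) hΘ hR0 hη).trans ?_)
    gcongr
  have hlim : Tendsto (fun n : ℕ => (Θ + 1) * ENNReal.ofReal (1 / ((n : ℝ) + 1) / η)) atTop
      (𝓝 0) := by
    have h1 : Tendsto (fun n : ℕ => ENNReal.ofReal (1 / ((n : ℝ) + 1) / η)) atTop (𝓝 0) := by
      rw [← ENNReal.ofReal_zero]
      refine ENNReal.tendsto_ofReal ?_
      simpa using tendsto_one_div_add_atTop_nhds_zero_nat.div_const η
    have h2 := ENNReal.Tendsto.const_mul (a := Θ + 1) h1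
      (Or.inr (ENNReal.add_ne_top.2 ⟨hΘ.ne, ENNReal.one_ne_top⟩))
    rwa [mul_zero] at h2
  exact nonpos_iff_eq_zero.1 (ge_of_tendsto' hlim fun n => hle _ (by positivity))

/-- A refinement of `ν`, if there is any. -/
noncomputable def chosenRefinement (h : ℝ → ℝ) (μ : Measure UnitAddCircle) (b : ℝ) (q : ℕ → ℕ)
    (N : ℕ) (L : Σ M : ℕ, Fin M → ℕ) (ν : Measure UnitAddCircle) : Measure UnitAddCircle :=
  open Classical in
  if H : ∃ ν', IsRefinement h μ b q N L.1 L.2 ν ν' then H.choose else ν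

/-- The successive refinements prescribed by a list of indices of cells. -/
noncomputable def iteratedRefinement (h : ℝ → ℝ) (μ : Measure UnitAddCircle) (b : ℝ) (q : ℕ → ℕ)
    (ν₀ : Measure UnitAddCircle) : List (ℕ × Σ M : ℕ, Fin M → ℕ) → Measure UnitAddCircle
  | [] => ν₀
  | p :: l => chosenRefinement h μ b q p.1 p.2 (iteratedRefinement h μ b q ν₀ l)

lemma isRefinement_chosenRefinement {μ : Measure UnitAddCircle} {b : ℝ} {q : ℕ → ℕ}
    {N M : ℕ} {c : Fin M → ℕ} {ν : Measure UnitAddCircle}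
    (H : ∃ ν', IsRefinement h μ b q N M c ν ν') :
    IsRefinement h μ b q N M c ν (chosenRefinement h μ b q N ⟨M, c⟩ ν) := by
  rw [chosenRefinement, dif_pos H]
  exact H.choose_spec

lemma isTame_iteratedRefinement {μ : Measure UnitAddCircle} {b : ℝ} {q : ℕ → ℕ}
    {ν₀ : Measure UnitAddCircle} (hν₀ : IsTame h μ b ν₀) :
    ∀ l, IsTame h μ b (iteratedRefinement h μ b q ν₀ l)
  | [] => hν₀
  | p :: l => by
    rw [iteratedRefinement, chosenRefinement]
    split_ifs with H
    · exact H.choose_spec.tame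
    · exact isTame_iteratedRefinement hν₀ l

/-- An infinite sequence of refinements produces points of the limsup set. -/
lemma hausdorffGauge_approxSet_inter_pos {x : ℕ → UnitAddCircle} (hr : ∀ n, 0 < r n)
    (hh : IsGauge h) {G : Set UnitAddCircle} (hG : IsCompact G) {μ : Measure UnitAddCircle}
    [IsFiniteMeasure μ] (hμG : μ Gᶜ = 0) {b : ℝ} (hb : 0 < b) {ν : ℕ → Measure UnitAddCircle}
    (hν0 : ν 0 ≪ μ) {M : ℕ → ℕ} (hν : ∀ i, IsTame h μ b (ν i))
    (href : ∀ i, IsRefinement h μ b (fun n => ⌈1 / r n⌉₊) i (M i) (cellIndices r x (M i))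
      (ν i) (ν (i + 1))) :
    0 < hausdorffGauge h (approxSet x r ∩ G) := by
  set q : ℕ → ℕ := fun n => ⌈1 / r n⌉₊ with hqdef
  have hq : ∀ n, 0 < q n := ceil_inv_pos hr
  let C : ℕ → Set UnitAddCircle := fun i => ⋃ n : Fin (M i), ⋃ _ : i ≤ (n : ℕ),
    closure (circleCell (q n) (cellIndex (q n) (x n)))
  let K : ℕ → Set UnitAddCircle := fun i => G ∩ ⋂ k, ⋂ _ : k < i, C k
  have hCc : ∀ i, IsClosed (C i) := fun i =>
    isClosed_iUnion_of_finite fun n => isClosed_iUnion_of_finite fun _ => isClosed_closure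
  have hK : ∀ i, IsCompact (K i) := fun i =>
    hG.inter_right (isClosed_iInter fun k => isClosed_iInter fun _ => hCc k)
  have hanti : Antitone K := fun i j hij y hy => ⟨hy.1, mem_iInter₂.2 fun k hk =>
    mem_iInter₂.1 hy.2 k (hk.trans_le hij)⟩
  -- Absolute continuity carries the null sets of earlier stages over to later ones, so `ν i` is
  -- carried by all the closed sets `C k` with `k < i`.
  have hac : ∀ i j, i ≤ j → ν j ≪ ν i := fun i j hij => by
    induction j, hij using Nat.le_induction with
    | base => exact Measure.AbsolutelyContinuous.rfl
    | succ j _ ih => exact (href j).ac.trans ih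
  have hνK : ∀ i, ν i (K i)ᶜ = 0 := by
    intro i
    have hsub : (K i)ᶜ ⊆ Gᶜ ∪ ⋃ k, ⋃ _ : k < i, (C k)ᶜ := by
      intro y hy
      by_cases hyG : y ∈ G
      · right
        by_contra hn
        simp only [mem_iUnion, not_exists, mem_compl_iff, not_not] at hn
        exact hy ⟨hyG, mem_iInter₂.2 hn⟩
      · exact Or.inl hyG
    refine measure_mono_null hsub (measure_union_null ?_ ?_)
    · exact (hac 0 i (Nat.zero_le _)) (hν0 hμG)
    · refine measure_iUnion_null fun k => measure_iUnion_null fun hk => ?_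
      refine hac (k + 1) i hk (measure_mono_null ?_ (href k).carried)
      intro y hy n hn he
      refine hy ?_
      refine mem_iUnion₂.2 ⟨n, hn, subset_closure ?_⟩
      rw [circleCell_eq_of_lt (cellIndex_lt (hq _) _)]
      exact he
  have hpos := hausdorffGauge_iInter_pos (K := K) (ν := ν) (c := ENNReal.ofReal b) (A := 6) hh hK
    hanti hνK (ENNReal.ofReal_pos.2 hb) (by simp)
    (fun i => by
      have := (hν i).isFiniteMeasure
      rw [← ofReal_measureReal]
      exact (ENNReal.ofReal_lt_ofReal_iff_of_nonneg hb.le).2 (hν i).lower)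
    (fun i k j => by
      have := (hν i).isFiniteMeasure
      rw [circleCell_eq (by positivity), ← ofReal_measureReal]
      refine (ENNReal.ofReal_le_ofReal ((hν i).cell k (j % 2 ^ k)).le).trans_eq ?_
      rw [ENNReal.ofReal_mul (by norm_num)]
      simp) countable_cellEndpoints
  refine hpos.trans_le (measure_mono ?_)
  rintro y ⟨hy, hyD⟩
  have hyK := mem_iInter.1 hy
  refine ⟨frequently_atTop.2 fun i => ?_, (hyK 0).1⟩
  have hyC : y ∈ C i := mem_iInter₂.1 (hyK (i + 1)).2 i (Nat.lt_succ_self i)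
  obtain ⟨n, hn, hyn⟩ := mem_iUnion₂.1 hyC
  refine ⟨n, hn, ?_⟩
  have h1 := (closure_circleCell_subset _ _ hyn).resolve_right hyD
  exact (dist_lt_of_mem_circleCell h1 (mem_circleCell_cellIndex (hq n) _)).trans_le
    (one_div_ceil_le hr n)

end Construction

/-! ### The initial measure and the conclusion. -/

/-- As `g / h` is bounded by `B * φ 1` on dyadic scales, dividing the Frostman measure by this
constant turns its `g`-bound into an `h`-bound. -/
lemma exists_isTame {g h φ : ℝ → ℝ} (hg : IsGauge g) (hh : IsGauge h) (hφ : IsGauge φ)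
    (hfast : IncreasesFaster φ h g) {μ : Measure UnitAddCircle} [IsFiniteMeasure μ]
    (hμ0 : 0 < μ univ)
    (hμ : ∀ k i, μ (circleCell (2 ^ k) i) ≤ ENNReal.ofReal (g ((2 : ℝ)⁻¹ ^ k))) :
    ∃ (b : ℝ) (ν : Measure UnitAddCircle), 0 < b ∧ ν ≪ μ ∧ IsTame h μ b ν := by
  obtain ⟨B, hB0, hB⟩ := hfast.exists_bound hg hh hφ
  have hφ1 : 0 < φ 1 := hφ.pos one_pos
  set s := (B * φ 1)⁻¹ with hs
  have hs0 : 0 < s := by positivity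
  have hreal : ∀ A, (ENNReal.ofReal s • μ).real A = s * μ.real A := fun A => by
    rw [measureReal_ennreal_smul_apply, ENNReal.toReal_ofReal hs0.le]
  have hm0 : 0 < μ.real univ := ENNReal.toReal_pos hμ0.ne' (measure_ne_top _ _)
  refine ⟨s * μ.real univ / 2, ENNReal.ofReal s • μ, by positivity,
    Measure.smul_absolutelyContinuous, ⟨s, hs0, le_rfl⟩, ?_, fun k l => ?_⟩
  · rw [hreal]
    exact half_lt_self (by positivity)
  · have hh0 : 0 < h ((2 : ℝ)⁻¹ ^ k) := hh.pos (by positivity)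
    have hg0 : 0 < g ((2 : ℝ)⁻¹ ^ k) := hg.pos (by positivity)
    rw [hreal]
    have h1 : μ.real {x | cellIndex (2 ^ k) x = l} ≤ g ((2 : ℝ)⁻¹ ^ k) := by
      rcases lt_or_ge l (2 ^ k) with hl | hl
      · rw [← circleCell_eq_of_lt hl]
        exact ENNReal.toReal_le_of_le_ofReal hg0.le (hμ k l)
      · rw [setOf_cellIndex_eq_empty (by positivity) hl, measureReal_empty]
        exact hg0.le
    have h2 : g ((2 : ℝ)⁻¹ ^ k) / h ((2 : ℝ)⁻¹ ^ k) ≤ B * φ 1 :=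
      (hB k).trans (mul_le_mul_of_nonneg_left
        (hφ.le (by positivity) (pow_le_one₀ (by norm_num) (by norm_num))) hB0.le)
    rw [div_le_iff₀ hh0] at h2
    calc s * μ.real {x | cellIndex (2 ^ k) x = l} ≤ s * (B * φ 1 * h ((2 : ℝ)⁻¹ ^ k)) := by
          gcongr; exact h1.trans h2
      _ = h ((2 : ℝ)⁻¹ ^ k) := by
          rw [hs, inv_mul_cancel_left₀ (by positivity)]
      _ < 6 * h ((2 : ℝ)⁻¹ ^ k) := by linarith

theorem mainTheorem7 {Ω : Type*} [MeasurableSpace Ω] (P : Measure Ω) [IsProbabilityMeasure P]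
    (X : ℕ → Ω → UnitAddCircle) (hX : ∀ n, Measurable (X n))
    (hXunif : ∀ n, Measure.map (X n) P = volume)
    (r : ℕ → ℝ) (hr : ∀ n, 0 < r n ∧ r n ≤ 1)
    (G : Set UnitAddCircle) (hGne : G.Nonempty) (hG : IsCompact G)
    (g : ℝ → ℝ) (hg : IsGauge g) (hgG : 0 < hausdorffGauge g G)
    (h φ : ℝ → ℝ) (hh : IsGauge h) (hφ : IsGauge φ) (hfast : IncreasesFaster φ h g)
    (hΘ : maxDependenceRatio P X (cellSequences r) < ∞)
    (hdiv : ¬ Summable fun n => r n / φ (r n)) :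
    ∀ᵐ ω ∂P, 0 < hausdorffGauge h (approxSet (fun n => X n ω) r ∩ G) := by
  obtain ⟨μ, hfin, hμ0, hμG, hμ⟩ := exists_frostman_measure hg hG.isClosed hgG
  obtain ⟨b, ν₀, hb, hac, hν₀⟩ := exists_isTame hg hh hφ hfast hμ0 hμ
  set q : ℕ → ℕ := fun n => ⌈1 / r n⌉₊ with hq
  -- There are only countably many lists, and each determines its measure without reference to `ω`;
  -- hence the almost sure statements hold simultaneously.
  have hae : ∀ᵐ ω ∂P, ∀ (l : List (ℕ × Σ M : ℕ, Fin M → ℕ)) (N : ℕ), ∃ M ν',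
      IsRefinement h μ b q N M (cellIndices r (fun n => X n ω) M)
        (iteratedRefinement h μ b q ν₀ l) ν' :=
    ae_all_iff.2 fun l => ae_all_iff.2 fun N =>
      ae_exists_isRefinement hX hXunif hr hg hh hφ hfast hΘ hdiv hμ
        (isTame_iteratedRefinement hν₀ l) N
  filter_upwards [hae] with ω hω
  choose M hM using hω
  -- Stage `i` uses only cells of index at least `i`, which yields infinitely many approximations.
  let s : ℕ → List (ℕ × Σ M : ℕ, Fin M → ℕ) := fun i =>
    Nat.rec [] (fun i l => (i, ⟨M l i, cellIndices r (fun n => X n ω) (M l i)⟩) :: l) i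
  exact hausdorffGauge_approxSet_inter_pos (ν := fun i => iteratedRefinement h μ b q ν₀ (s i))
    (M := fun i => M (s i) i) (fun n => (hr n).1) hh hG hμG hb hac
    (fun i => isTame_iteratedRefinement hν₀ _)
    fun i => isRefinement_chosenRefinement (hM (s i) i)
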